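/- **Second-order convergence of the semi-explicit scheme.** *Setting.* Let $V$, $H$, $Q$ be real Hilbert spaces with a bounded linear embedding $\iota\colon Q\to H$ (suppressed below), and let $a$ on $V\times V$, $b$ on $Q\times Q$, $c$ on $H\times H$, $d$ on $V\times H$ be bounded real bilinear forms such that $a,b,c$ are symmetric and, with positive constants, $$a(u,u)\ge c_a\|u\|_V^2,\quad b(p,p)\ge c_b\|p\|_Q^2,\quad c(p,p)\ge c_c\|p\|_H^2,\quad d(u,p)\le C_d\|u\|_V\|p\|_H .$$ Let $T>0$, $f\colon[0,T]\to V^*$, $g\colon[0,T]\to Q^*$, and let $(u,p)\colon[0,T]\to V\times Q$ solve $$a(u,v)-d(v,p)=\langle f,v\rangle\ \text{ on } [0,T],\qquad d(\dot u,q)+c(\dot p,q)+b(p,q)=\langle g,q\rangle\ \text{ on } (0,T]$$ for all $v\in V$, $q\in Q$. Let the data be so smooth that $u\in C^3([0,T];V)$ and $p\in C^3([0,T];H)$. *Scheme.* For $\tau>0$ with $N=T/\tau\in\mathbb N$ and $t^n=n\tau$, put $p^0=p(0)$, let $p^1\in Q$, let $u^0,u^1\in V$ be consistent, i.e. $a(u^k,v)-d(v,p^k)=\langle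 f(t^k),v\rangle$ for all $v\in V$, $k=0,1$, and for $0\le n\le N-2$ let $$a(u^{n+2},v)-d(v,2p^{n+1}-p^n)=\langle f(t^{n+2}),v\rangle ,$$ $$\tfrac1{2\tau}d(3u^{n+2}-4u^{n+1}+u^n,q)+\tfrac1{2\tau}c(3p^{n+2}-4p^{n+1}+p^n,q)+b(p^{n+2},q)=\langle g(t^{n+2}),q\rangle$$ for all $v\in V$, $q\in Q$. *Theorem.* Assume the weak coupling condition $\omega=C_d^2/(c_ac_c)\le\frac15$. For every $K$ there is a constant $C$, depending only on the spaces, the embedding, the forms and $K$ (not on $T$, $\tau$, $n$ or the data), such that the following holds whenever $u$ and $p$ and their derivatives up to order three are bounded by $K$ on $[0,T]$ in $V$ and in $H$, respectively, and $p^1$ is a second-order approximation of $p(\tau)$ in the sense that $$\|p(\tau)-p^1\|_H^2+\tau\|p(\tau)-p^1\|_Q^2\le K\tau^4 .$$ Consistent $u^0,u^1$ and iterates $u^n,p^n$ of the scheme exist, and every such sequence satisfies, for all $0\le n\le N$, $$\|u(t^n)-u^n\|_V^2+\|p(t^n)-p^n\|_H^2+\tau\sum_{j=1}^n\|p(t^j)-p^j\|_Q^2\le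 C\,(1+t^n)\,\tau^4 .$$ *Linear poroelasticity.* In particular, the same conclusion holds for a bounded open set $\Omega\subset\mathbb R^m$, $m\in\{2,3\}$, with $V=[H^1_0(\Omega)]^m$, $H=L^2(\Omega)$, $Q=H^1_0(\Omega)$ (with their $H^1$- and $L^2$-norms) and $$a(u,v)=\int_\Omega\sigma(u):\varepsilon(v),\quad b(p,q)=\int_\Omega\tfrac{\kappa}{\nu}\nabla p\cdot\nabla q,\quad c(p,q)=\int_\Omega\tfrac1M\,p\,q,\quad d(u,q)=\int_\Omega\alpha\,(\nabla\cdot u)\,q,$$ where $\varepsilon(u)=\frac12(\nabla u+(\nabla u)^T)$, $\sigma(u)=\mu(\nabla u+(\nabla u)^T)+\lambda(\nabla\cdot u)\,\mathrm{id}$, the coefficients are real numbers with $\kappa,\nu,M>0$, and $c_a,c_c,C_d>0$ are any constants with $a(u,u)\ge c_a\|\nabla u\|_{L^2}^2$, $c(p,p)\ge c_c\|p\|_{L^2}^2$, $d(u,q)\le C_d\|\nabla u\|_{L^2}\|q\|_{L^2}$ and $C_d^2/(c_ac_c)\le\frac15$. -/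

import Mathlib

open MeasureTheory Set
open scoped ContDiff

noncomputable section

/-! ### The abstract elliptic-parabolic system -/

/-- The bounded bilinear forms of a coupled elliptic-parabolic system on the spaces `V`
(displacement), `H` (pivot space of the pressure) and `Q` (pressure), together with the bounded
embedding `ι : Q → H`. The form `b` lives on `Q`, the form `c` on `H`; `c (p, q)` for `p, q` in `Q`
is `c (ι p) (ι q)`, and `d (u, q)` is `d u (ι q)`. -/
structure EllipticParabolicForms (V H Q : Type*)
    [NormedAddCommGroup V] [InnerProductSpace ℝ V]
    [NormedAddCommGroup H] [InnerProductSpace ℝ H]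
    [NormedAddCommGroup Q] [InnerProductSpace ℝ Q] where
  ι : Q →L[ℝ] H
  a : V →L[ℝ] V →L[ℝ] ℝ
  b : Q →L[ℝ] Q →L[ℝ] ℝ
  c : H →L[ℝ] H →L[ℝ] ℝ
  d : V →L[ℝ] H →L[ℝ] ℝ

/-- `BDF₂ yⁿ⁺² = 3 yⁿ⁺² - 4 yⁿ⁺¹ + yⁿ`. -/
def bdf2 {E : Type*} [AddCommGroup E] [Module ℝ E] (y : ℕ → E) (n : ℕ) : E :=
  (3 : ℝ) • y (n + 2) - (4 : ℝ) • y (n + 1) + y n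

/-- `y` is three times continuously differentiable on `[0, T]` (one-sided derivatives at the end
points), and `y` and its first three derivatives are bounded by `K` there. -/
def C3BoundedBy {E : Type*} [NormedAddCommGroup E] [NormedSpace ℝ E]
    (T K : ℝ) (y : ℝ → E) : Prop :=
  ContDiffOn ℝ 3 y (Icc 0 T) ∧
    ∀ k ≤ 3, ∀ t ∈ Icc (0 : ℝ) T, ‖iteratedDerivWithin k y (Icc 0 T) t‖ ≤ K

section

variable {V H Q : Type*}
  [NormedAddCommGroup V] [InnerProductSpace ℝ V]
  [NormedAddCommGroup H] [InnerProductSpace ℝ H]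
  [NormedAddCommGroup Q] [InnerProductSpace ℝ Q]

/-- `(u, p)` solves the variational system
`a (u, v) - d (v, p) = ⟨f, v⟩`, `d (u', q) + c (p', q) + b (p, q) = ⟨g, q⟩`. -/
structure EllipticParabolicForms.IsSolution (S : EllipticParabolicForms V H Q) (T : ℝ)
    (f : ℝ → V →L[ℝ] ℝ) (g : ℝ → Q →L[ℝ] ℝ) (u : ℝ → V) (p : ℝ → Q) : Prop where
  elliptic : ∀ t ∈ Icc 0 T, ∀ v : V, S.a (u t) v - S.d v (S.ι (p t)) = f t v
  parabolic : ∀ t ∈ Ioc 0 T, ∀ q : Q,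
    S.d (derivWithin u (Icc 0 T) t) (S.ι q)
      + S.c (derivWithin (fun s => S.ι (p s)) (Icc 0 T) t) (S.ι q)
      + S.b (p t) q = g t q

/-- `(uⁿ, pⁿ)`, `n = 0, …, N`, is produced by the decoupled BDF-2-based semi-explicit scheme with
step size `τ` from the initial values `p⁰`, `p¹` and the consistent values `u⁰`, `u¹`. -/
structure EllipticParabolicForms.IsSemiExplicit (S : EllipticParabolicForms V H Q)
    (τ : ℝ) (N : ℕ) (f : ℝ → V →L[ℝ] ℝ) (g : ℝ → Q →L[ℝ] ℝ) (p₀ p₁ : Q)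
    (un : ℕ → V) (pn : ℕ → Q) : Prop where
  p_zero : pn 0 = p₀
  p_one : pn 1 = p₁
  u_zero : ∀ v : V, S.a (un 0) v - S.d v (S.ι (pn 0)) = f 0 v
  u_one : ∀ v : V, S.a (un 1) v - S.d v (S.ι (pn 1)) = f τ v
  step_u : ∀ n : ℕ, n + 2 ≤ N → ∀ v : V,
    S.a (un (n + 2)) v - S.d v (S.ι ((2 : ℝ) • pn (n + 1) - pn n)) = f (((n + 2 : ℕ) : ℝ) * τ) v
  step_p : ∀ n : ℕ, n + 2 ≤ N → ∀ q : Q,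
    1 / (2 * τ) * S.d (bdf2 un n) (S.ι q) + 1 / (2 * τ) * S.c (S.ι (bdf2 pn n)) (S.ι q)
      + S.b (pn (n + 2)) q = g (((n + 2 : ℕ) : ℝ) * τ) q

/-- Second-order convergence of the semi-explicit scheme: for every size `K` of the exact solution
(in `C³`) and of the constant in the second-order accuracy of `p¹` there is a constant `C` such
that, for all time horizons, data, step sizes and admissible `p¹`, the scheme has a solution with
consistent `u⁰`, `u¹`, and every such solution satisfies the error estimate. -/
def EllipticParabolicForms.SecondOrderConvergence (S : EllipticParabolicForms V H Q) : Prop :=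
  ∀ K : ℝ, ∃ C : ℝ, ∀ T : ℝ, 0 < T →
    ∀ (f : ℝ → V →L[ℝ] ℝ) (g : ℝ → Q →L[ℝ] ℝ) (u : ℝ → V) (p : ℝ → Q),
      S.IsSolution T f g u p →
      C3BoundedBy T K u →
      C3BoundedBy T K (fun t => S.ι (p t)) →
      ∀ (τ : ℝ) (N : ℕ), 0 < τ → (N : ℝ) * τ = T →
        ∀ p₁ : Q, ‖S.ι (p τ - p₁)‖ ^ 2 + τ * ‖p τ - p₁‖ ^ 2 ≤ K * τ ^ 4 →
          (∃ (un : ℕ → V) (pn : ℕ → Q), S.IsSemiExplicit τ N f g (p 0) p₁ un pn) ∧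
          ∀ (un : ℕ → V) (pn : ℕ → Q), S.IsSemiExplicit τ N f g (p 0) p₁ un pn →
            ∀ n ≤ N,
              ‖u (n * τ) - un n‖ ^ 2 + ‖S.ι (p (n * τ) - pn n)‖ ^ 2
                  + τ * ∑ j ∈ Finset.Icc 1 n, ‖p (j * τ) - pn j‖ ^ 2
                ≤ C * (1 + n * τ) * τ ^ 4

end

/-! ### Linear poroelasticity -/

namespace Poroelasticity

variable {m : ℕ}

/-- `L²(Ω)`. -/
abbrev L2 (Ω : Set (EuclideanSpace ℝ (Fin m))) : Type :=
  Lp ℝ 2 (volume.restrict Ω)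

/-- The Hilbert space `L²(Ω) × L²(Ω)ᵐ` of pairs (function, candidate gradient). -/
abbrev L2Graph (Ω : Set (EuclideanSpace ℝ (Fin m))) : Type :=
  WithLp 2 (L2 Ω × PiLp 2 (fun _ : Fin m => L2 Ω))

/-- `H¹₀(Ω)`: the closure of the test functions `C_c^∞(Ω)` with respect to the norm
`(‖φ‖² + ‖∇φ‖²)^(1/2)`, an element being stored as the pair of the function and its gradient. -/
def H10 (Ω : Set (EuclideanSpace ℝ (Fin m))) : Submodule ℝ (L2Graph Ω) :=
  (Submodule.span ℝ
    {w : L2Graph Ω | ∃ φ : EuclideanSpace ℝ (Fin m) → ℝ,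
      ContDiff ℝ ∞ φ ∧ HasCompactSupport φ ∧ tsupport φ ⊆ Ω ∧
      w.fst =ᵐ[volume.restrict Ω] φ ∧
      ∀ i : Fin m, w.snd i =ᵐ[volume.restrict Ω]
        fun x => fderiv ℝ φ x (EuclideanSpace.single i 1)}).topologicalClosure

/-- The space `[H¹₀(Ω)]ᵐ` of displacements. -/
abbrev Displacement (Ω : Set (EuclideanSpace ℝ (Fin m))) : Type :=
  PiLp 2 (fun _ : Fin m => H10 Ω)

variable (Ω : Set (EuclideanSpace ℝ (Fin m)))

/-- The embedding `H¹₀(Ω) → L²(Ω)`. -/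
def toL2 : H10 Ω →L[ℝ] L2 Ω :=
  (WithLp.fstL 2 ℝ (L2 Ω) (PiLp 2 (fun _ : Fin m => L2 Ω))).comp (H10 Ω).subtypeL

/-- The partial derivative `∂ᵢ : H¹₀(Ω) → L²(Ω)`. -/
def partialDeriv (i : Fin m) : H10 Ω →L[ℝ] L2 Ω :=
  (PiLp.proj 2 (fun _ : Fin m => L2 Ω) i).comp
    ((WithLp.sndL 2 ℝ (L2 Ω) (PiLp 2 (fun _ : Fin m => L2 Ω))).comp (H10 Ω).subtypeL)

/-- `(∇u)ᵢⱼ = ∂ⱼ uᵢ`. -/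
def grad (i j : Fin m) : Displacement Ω →L[ℝ] L2 Ω :=
  (partialDeriv Ω j).comp (PiLp.proj 2 (fun _ : Fin m => H10 Ω) i)

/-- `∇ · u`. -/
def divergence : Displacement Ω →L[ℝ] L2 Ω :=
  ∑ i, grad Ω i i

/-- The symmetric gradient `ε(u) = (∇u + (∇u)ᵀ) / 2`. -/
def strain (i j : Fin m) : Displacement Ω →L[ℝ] L2 Ω :=
  (1 / 2 : ℝ) • (grad Ω i j + grad Ω j i)

/-- The stress tensor `σ(u) = μ (∇u + (∇u)ᵀ) + lam (∇ · u) id`. -/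
def stress (μ lam : ℝ) (i j : Fin m) : Displacement Ω →L[ℝ] L2 Ω :=
  μ • (grad Ω i j + grad Ω j i) + if i = j then lam • divergence Ω else 0

/-- The gradient norm `‖∇u‖_{L²(Ω)}` of a displacement. -/
def gradNorm (u : Displacement Ω) : ℝ :=
  Real.sqrt (∑ i, ∑ j, ‖grad Ω i j u‖ ^ 2)

/-- The forms of linear poroelasticity,
`a (u, v) = ∫_Ω σ(u) : ε(v)`, `b (p, q) = ∫_Ω (κ/ν) ∇p · ∇q`, `c (p, q) = ∫_Ω (1/M) p q`,
`d (u, q) = ∫_Ω α (∇ · u) q`, with the integrals written as inner products of `L²(Ω)`. -/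
def forms (μ lam κ ν α M : ℝ) :
    EllipticParabolicForms (Displacement Ω) (L2 Ω) (H10 Ω) where
  ι := toL2 Ω
  a := ∑ i, ∑ j, (innerSL ℝ).bilinearComp (stress Ω μ lam i j) (strain Ω i j)
  b := (κ / ν) • ∑ i, (innerSL ℝ).bilinearComp (partialDeriv Ω i) (partialDeriv Ω i)
  c := (1 / M) • innerSL ℝ
  d := α • (innerSL ℝ).comp (divergence Ω)

end Poroelasticity

end

/-! The displacement is eliminated. Coercivity of `a` gives `L : H → V` with a(Lz, v) = d(v, z), and
s(p, q) = d(Lp, q) is a symmetric, nonnegative form on `H`; the coupling condition says 5s ≤ c. With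
y the pressure error in `H`, the displacement error is L zⁿ, where zⁿ⁺² = 2yⁿ⁺¹ - yⁿ + Δⁿ and Δⁿ is
the second difference of the exact pressure. Testing the parabolic error equation with its own error
bounds c(BDF₂ y, y) + s(BDF₂ z, y) + 2τ b(e, e) by O(τ³)‖y‖.

The decisive point is a discrete energy for this delayed recursion. Split c = (c - 3s) + 3s. The
first part is coercive and is handled by the classical G-stability of BDF-2 (`bdf2Energy_sub_le`).
The remainder 3s(BDF₂ y, y) + s(BDF₂ of the extrapolation, y) dominates the increment of a
four-level quadratic energy (`extrapolatedEnergy_sub_le`). The factor 3 cannot be lowered: on yⁿ =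
(-1)ⁿx the expression with factor λ equals (8λ - 24) s(x, x).

Half of the dissipation of b absorbs the residual, at a cost of O(τ⁵) per step. The energy
inequality therefore telescopes without Grönwall, which is why the bound grows only linearly in time
(`exists_energy_estimate`).

For poroelasticity, Poincaré's inequality makes a and b coercive in the full norms. The coupling is
compared with the forms a and c themselves, so the Poincaré constant does not affect its threshold.
-/

/-! ### Taylor remainders and consistency of the difference formulas -/

section Taylor

variable {E : Type*} [NormedAddCommGroup E] [NormedSpace ℝ E]

/-- The mean value inequality replaces integration of the derivative bound: no integral is needed,
at the price of the factor 1/(k + 1). Iterating it yields Taylor remainders without factorials. -/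
theorem norm_le_of_hasDerivWithinAt_of_norm_le_pow {T x K : ℝ} {g g' : ℝ → E} (k : ℕ)
    (hx : x ∈ Icc 0 T) (h0 : g x = 0)
    (hg : ∀ t ∈ Icc 0 T, HasDerivWithinAt g (g' t) (Icc 0 T) t)
    (hK : ∀ t ∈ Icc x T, ‖g' t‖ ≤ K * (t - x) ^ k) {y : ℝ} (hy : y ∈ Icc x T) :
    ‖g y‖ ≤ K * (y - x) ^ (k + 1) := by
  have hK0 : 0 ≤ K * (y - x) ^ k := (norm_nonneg _).trans (hK y hy)
  rcases hy.1.eq_or_lt with h | hlt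
  · subst h
    simp [h0]
  have hKnn : 0 ≤ K := nonneg_of_mul_nonneg_left hK0 (pow_pos (sub_pos.2 hlt) k)
  have hsub : Icc x y ⊆ Icc 0 T := Icc_subset_Icc hx.1 hy.2
  have h := Convex.norm_image_sub_le_of_norm_hasDerivWithin_le (f := g) (f' := g')
    (s := Icc x y) (C := K * (y - x) ^ k)
    (fun t ht => (hg t (hsub ht)).mono hsub)
    (fun t ht => (hK t ⟨ht.1, ht.2.trans hy.2⟩).trans (by
      have h1 : 0 ≤ t - x := sub_nonneg.2 ht.1
      have h2 : t - x ≤ y - x := by linarith [ht.2]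
      gcongr))
    (convex_Icc x y) (left_mem_Icc.2 hy.1) (right_mem_Icc.2 hy.1)
  rw [h0, sub_zero, Real.norm_of_nonneg (sub_nonneg.2 hy.1)] at h
  linarith [show K * (y - x) ^ (k + 1) = K * (y - x) ^ k * (y - x) by ring]

variable {T K : ℝ} {f : ℝ → E}

theorem C3BoundedBy.nonneg (hT : 0 < T) (hf : C3BoundedBy T K f) : 0 ≤ K :=
  (norm_nonneg _).trans (hf.2 0 (by norm_num) 0 ⟨le_rfl, hT.le⟩)

theorem C3BoundedBy.hasDerivWithinAt (hT : 0 < T) (hf : C3BoundedBy T K f) {k : ℕ} (hk : k < 3)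
    {t : ℝ} (ht : t ∈ Icc 0 T) :
    HasDerivWithinAt (iteratedDerivWithin k f (Icc 0 T))
      (iteratedDerivWithin (k + 1) f (Icc 0 T) t) (Icc 0 T) t := by
  have hd := hf.1.differentiableOn_iteratedDerivWithin (m := k) (by exact_mod_cast hk)
    (uniqueDiffOn_Icc hT) t ht
  rw [iteratedDerivWithin_succ]
  exact hd.hasDerivWithinAt

variable {x y : ℝ}

theorem C3BoundedBy.norm_taylor_zero_le (hT : 0 < T) (hf : C3BoundedBy T K f) {k : ℕ} (hk : k < 3)
    (hx : x ∈ Icc 0 T) (hy : y ∈ Icc x T) :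
    ‖iteratedDerivWithin k f (Icc 0 T) y - iteratedDerivWithin k f (Icc 0 T) x‖
      ≤ K * (y - x) := by
  have := norm_le_of_hasDerivWithinAt_of_norm_le_pow (K := K)
    (g := fun y => iteratedDerivWithin k f (Icc 0 T) y - iteratedDerivWithin k f (Icc 0 T) x)
    0 hx (by simp) (fun t ht => (hf.hasDerivWithinAt hT hk ht).sub_const _)
    (fun t ht => by simpa using hf.2 (k + 1) hk t ⟨hx.1.trans ht.1, ht.2⟩) hy
  simpa using this

theorem C3BoundedBy.norm_taylor_one_le (hT : 0 < T) (hf : C3BoundedBy T K f) {k : ℕ} (hk : k < 2)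
    (hx : x ∈ Icc 0 T) (hy : y ∈ Icc x T) :
    ‖iteratedDerivWithin k f (Icc 0 T) y - iteratedDerivWithin k f (Icc 0 T) x
      - (y - x) • iteratedDerivWithin (k + 1) f (Icc 0 T) x‖ ≤ K * (y - x) ^ 2 := by
  refine norm_le_of_hasDerivWithinAt_of_norm_le_pow (K := K)
    (g := fun y => iteratedDerivWithin k f (Icc 0 T) y - iteratedDerivWithin k f (Icc 0 T) x
      - (y - x) • iteratedDerivWithin (k + 1) f (Icc 0 T) x)
    (g' := fun y => iteratedDerivWithin (k + 1) f (Icc 0 T) y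
      - (1 : ℝ) • iteratedDerivWithin (k + 1) f (Icc 0 T) x)
    1 hx (by simp) (fun t ht => ?_) (fun t ht => ?_) hy
  · exact ((hf.hasDerivWithinAt hT (by omega) ht).sub_const _).sub
      (((hasDerivWithinAt_id t _).sub_const x).smul_const _)
  · simpa using hf.norm_taylor_zero_le hT (k := k + 1) (by omega) hx ht

theorem C3BoundedBy.norm_taylor_two_le (hT : 0 < T) (hf : C3BoundedBy T K f)
    (hx : x ∈ Icc 0 T) (hy : y ∈ Icc x T) :
    ‖f y - f x - (y - x) • iteratedDerivWithin 1 f (Icc 0 T) x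
      - ((y - x) ^ 2 / 2) • iteratedDerivWithin 2 f (Icc 0 T) x‖ ≤ K * (y - x) ^ 3 := by
  refine norm_le_of_hasDerivWithinAt_of_norm_le_pow (K := K)
    (g := fun y => f y - f x - (y - x) • iteratedDerivWithin 1 f (Icc 0 T) x
      - ((y - x) ^ 2 / 2) • iteratedDerivWithin 2 f (Icc 0 T) x)
    (g' := fun y => iteratedDerivWithin 1 f (Icc 0 T) y
      - (1 : ℝ) • iteratedDerivWithin 1 f (Icc 0 T) x
      - (y - x) • iteratedDerivWithin 2 f (Icc 0 T) x)
    2 hx (by simp) (fun t ht => ?_) (fun t ht => ?_) hy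
  · have h0 := hf.hasDerivWithinAt hT (k := 0) (by omega) ht
    rw [iteratedDerivWithin_zero] at h0
    have h2 : HasDerivWithinAt (fun y : ℝ => (y - x) ^ 2 / 2) (t - x) (Icc 0 T) t := by
      have := ((((hasDerivWithinAt_id t (Icc 0 T)).sub_const x).pow 2).div_const 2)
      convert! this using 1
      simp
    exact ((h0.sub_const _).sub (((hasDerivWithinAt_id t _).sub_const x).smul_const _)).sub
      (h2.smul_const _)
  · simpa using hf.norm_taylor_one_le hT (k := 1) (by omega) hx ht

variable {h : ℝ}

theorem C3BoundedBy.norm_second_difference_le (hT : 0 < T) (hf : C3BoundedBy T K f)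
    (hx : 0 ≤ x) (hh : 0 ≤ h) (hxT : x + 2 * h ≤ T) :
    ‖f (x + 2 * h) - (2 : ℝ) • f (x + h) + f x‖ ≤ 6 * K * h ^ 2 := by
  have hm : x ∈ Icc 0 T := ⟨hx, by linarith⟩
  have h1 := hf.norm_taylor_one_le hT (k := 0) (y := x + h) (by omega) hm
    ⟨by linarith, by linarith⟩
  have h2 := hf.norm_taylor_one_le hT (k := 0) (y := x + 2 * h) (by omega) hm
    ⟨by linarith, by linarith⟩
  simp only [iteratedDerivWithin_zero, zero_add, add_sub_cancel_left] at h1 h2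
  set r₁ := f (x + h) - f x - h • iteratedDerivWithin 1 f (Icc 0 T) x
  set r₂ := f (x + 2 * h) - f x - (2 * h) • iteratedDerivWithin 1 f (Icc 0 T) x
  have : f (x + 2 * h) - (2 : ℝ) • f (x + h) + f x = r₂ - (2 : ℝ) • r₁ := by
    simp only [r₁, r₂]; module
  rw [this]
  calc _ ≤ ‖r₂‖ + ‖(2 : ℝ) • r₁‖ := norm_sub_le _ _
    _ = ‖r₂‖ + 2 * ‖r₁‖ := by rw [norm_smul]; norm_num
    _ ≤ _ := by linarith

theorem C3BoundedBy.norm_third_difference_le (hT : 0 < T) (hf : C3BoundedBy T K f)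
    (hx : 0 ≤ x) (hh : 0 ≤ h) (hxT : x + 3 * h ≤ T) :
    ‖f (x + 3 * h) - (3 : ℝ) • f (x + 2 * h) + (3 : ℝ) • f (x + h) - f x‖
      ≤ 54 * K * h ^ 3 := by
  have hm : x ∈ Icc 0 T := ⟨hx, by linarith⟩
  have h1 := hf.norm_taylor_two_le hT (y := x + h) hm ⟨by linarith, by linarith⟩
  have h2 := hf.norm_taylor_two_le hT (y := x + 2 * h) hm ⟨by linarith, by linarith⟩
  have h3 := hf.norm_taylor_two_le hT (y := x + 3 * h) hm ⟨by linarith, by linarith⟩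
  simp only [add_sub_cancel_left] at h1 h2 h3
  set f₁ := iteratedDerivWithin 1 f (Icc 0 T) x
  set f₂ := iteratedDerivWithin 2 f (Icc 0 T) x
  set r₁ := f (x + h) - f x - h • f₁ - (h ^ 2 / 2) • f₂
  set r₂ := f (x + 2 * h) - f x - (2 * h) • f₁ - ((2 * h) ^ 2 / 2) • f₂
  set r₃ := f (x + 3 * h) - f x - (3 * h) • f₁ - ((3 * h) ^ 2 / 2) • f₂
  -- The third difference annihilates quadratics, so only remainders survive; 54 = 27 + 3·8 + 3·1.
  have : f (x + 3 * h) - (3 : ℝ) • f (x + 2 * h) + (3 : ℝ) • f (x + h) - f x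
      = r₃ - (3 : ℝ) • r₂ + (3 : ℝ) • r₁ := by
    simp only [r₁, r₂, r₃]; module
  rw [this]
  calc _ ≤ ‖r₃‖ + ‖(3 : ℝ) • r₂‖ + ‖(3 : ℝ) • r₁‖ :=
        (norm_add_le _ _).trans (add_le_add_left (norm_sub_le _ _) _)
    _ = ‖r₃‖ + 3 * ‖r₂‖ + 3 * ‖r₁‖ := by simp only [norm_smul]; norm_num
    _ ≤ _ := by nlinarith

/-- Consistency of the BDF-2 difference quotient. -/
theorem C3BoundedBy.norm_bdf2_consistency_le (hT : 0 < T) (hf : C3BoundedBy T K f)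
    (hx : 0 ≤ x) (hh : 0 ≤ h) (hxT : x + 2 * h ≤ T) :
    ‖(3 : ℝ) • f (x + 2 * h) - (4 : ℝ) • f (x + h) + f x
        - (2 * h) • derivWithin f (Icc 0 T) (x + 2 * h)‖ ≤ 36 * K * h ^ 3 := by
  have hm : x ∈ Icc 0 T := ⟨hx, by linarith⟩
  have h1 := hf.norm_taylor_two_le hT (y := x + h) hm ⟨by linarith, by linarith⟩
  have h2 := hf.norm_taylor_two_le hT (y := x + 2 * h) hm ⟨by linarith, by linarith⟩
  have h3 := hf.norm_taylor_one_le hT (k := 1) (y := x + 2 * h) (by omega) hm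
    ⟨by linarith, by linarith⟩
  rw [← iteratedDerivWithin_one]
  simp only [add_sub_cancel_left, Nat.reduceAdd] at h1 h2 h3
  set f₁ := iteratedDerivWithin 1 f (Icc 0 T)
  set f₂ := iteratedDerivWithin 2 f (Icc 0 T) x
  set r₁ := f (x + h) - f x - h • f₁ x - (h ^ 2 / 2) • f₂
  set r₂ := f (x + 2 * h) - f x - (2 * h) • f₁ x - ((2 * h) ^ 2 / 2) • f₂
  set r₃ := f₁ (x + 2 * h) - f₁ x - (2 * h) • f₂
  -- BDF-2 differentiates quadratics exactly; 36 = 3·8 + 4·1 + 2·4.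
  have : (3 : ℝ) • f (x + 2 * h) - (4 : ℝ) • f (x + h) + f x - (2 * h) • f₁ (x + 2 * h)
      = (3 : ℝ) • r₂ - (4 : ℝ) • r₁ - (2 * h) • r₃ := by
    simp only [r₁, r₂, r₃]; module
  rw [this]
  calc _ ≤ ‖(3 : ℝ) • r₂‖ + ‖(4 : ℝ) • r₁‖ + ‖(2 * h) • r₃‖ :=
        (norm_sub_le _ _).trans (add_le_add_left (norm_sub_le _ _) _)
    _ = 3 * ‖r₂‖ + 4 * ‖r₁‖ + 2 * h * ‖r₃‖ := by
        simp only [norm_smul, Real.norm_of_nonneg (mul_nonneg zero_le_two hh)]; norm_num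
    _ ≤ _ := by nlinarith [mul_le_mul_of_nonneg_left h3 hh]

end Taylor

/-! ### Quadratic energies and single-step bounds -/

section Energy

variable {H : Type*} [NormedAddCommGroup H] [NormedSpace ℝ H]

/-- The energy of the BDF-2 method. -/
noncomputable def bdf2Energy (m : H →L[ℝ] H →L[ℝ] ℝ) (y₀ y₁ : H) : ℝ :=
  1 / 2 * m y₁ y₁ + 1 / 2 * m ((2 : ℝ) • y₁ - y₀) ((2 : ℝ) • y₁ - y₀)

/-- The energy of the BDF-2 method perturbed by its composition with the extrapolation
`2 yⁿ⁺¹ - yⁿ` at the critical coupling strength `1 / 3`. -/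
noncomputable def extrapolatedEnergy (m : H →L[ℝ] H →L[ℝ] ℝ) (y₀ y₁ y₂ y₃ : H) : ℝ :=
  1 / 2 * m (y₀ - (2 : ℝ) • y₁ + (2 : ℝ) • y₃) (y₀ - (2 : ℝ) • y₁ + (2 : ℝ) • y₃)
    + 1 / 6 * m ((3 : ℝ) • y₁ - (4 : ℝ) • y₂ - (2 : ℝ) • y₃)
        ((3 : ℝ) • y₁ - (4 : ℝ) • y₂ - (2 : ℝ) • y₃)
    + 1 / 66 * m ((11 : ℝ) • y₂ - (14 : ℝ) • y₃) ((11 : ℝ) • y₂ - (14 : ℝ) • y₃)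
    + 41 / 22 * m y₃ y₃

variable {m : H →L[ℝ] H →L[ℝ] ℝ}

theorem half_apply_le_bdf2Energy (hm : ∀ p, 0 ≤ m p p) (y₀ y₁ : H) :
    1 / 2 * m y₁ y₁ ≤ bdf2Energy m y₀ y₁ := by
  unfold bdf2Energy
  linarith [hm ((2 : ℝ) • y₁ - y₀)]

theorem extrapolatedEnergy_nonneg (hm : ∀ p, 0 ≤ m p p) (y₀ y₁ y₂ y₃ : H) :
    0 ≤ extrapolatedEnergy m y₀ y₁ y₂ y₃ := by
  unfold extrapolatedEnergy
  linarith [hm (y₀ - (2 : ℝ) • y₁ + (2 : ℝ) • y₃), hm y₃,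
    hm ((3 : ℝ) • y₁ - (4 : ℝ) • y₂ - (2 : ℝ) • y₃), hm ((11 : ℝ) • y₂ - (14 : ℝ) • y₃)]

/-- G-stability of BDF-2: the slack is exactly half the `m`-square of the second difference. -/
theorem bdf2Energy_sub_le (hsymm : ∀ p q, m p q = m q p) (hm : ∀ p, 0 ≤ m p p) (y₀ y₁ y₂ : H) :
    bdf2Energy m y₁ y₂ - bdf2Energy m y₀ y₁
      ≤ m ((3 : ℝ) • y₂ - (4 : ℝ) • y₁ + y₀) y₂ := by
  have h := hm (y₂ - (2 : ℝ) • y₁ + y₀)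
  unfold bdf2Energy
  simp only [map_add, map_sub, map_smul, add_apply, sub_apply, smul_apply,
    smul_eq_mul] at h ⊢
  linarith [hsymm y₀ y₁, hsymm y₀ y₂, hsymm y₁ y₂]

/-- The slack is half the `m`-square of y₀ - 2y₁ + 2y₃ - y₄ plus the `m`-square of y₁ - y₂ - y₃ +
y₄. Both vanish on constant and on alternating sequences, the modes on which the right-hand side
degenerates. The combination 6y₃ - 11y₂ + 6y₁ - y₀ is BDF₂ applied to the extrapolation 2yⁿ⁺¹ - yⁿ.
-/
theorem extrapolatedEnergy_sub_le (hsymm : ∀ p q, m p q = m q p) (hm : ∀ p, 0 ≤ m p p)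
    (y₀ y₁ y₂ y₃ y₄ : H) :
    extrapolatedEnergy m y₁ y₂ y₃ y₄ - extrapolatedEnergy m y₀ y₁ y₂ y₃
      ≤ 3 * m ((3 : ℝ) • y₄ - (4 : ℝ) • y₃ + y₂) y₄
        + m ((6 : ℝ) • y₃ - (11 : ℝ) • y₂ + (6 : ℝ) • y₁ - y₀) y₄ := by
  have h₁ := hm (y₀ - (2 : ℝ) • y₁ + (2 : ℝ) • y₃ - y₄)
  have h₂ := hm (y₁ - y₂ - y₃ + y₄)
  unfold extrapolatedEnergy
  simp only [map_add, map_sub, map_smul, add_apply, sub_apply, smul_apply,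
    smul_eq_mul] at h₁ h₂ ⊢
  linarith [hsymm y₀ y₁, hsymm y₀ y₂, hsymm y₀ y₃, hsymm y₀ y₄, hsymm y₁ y₂, hsymm y₁ y₃,
    hsymm y₁ y₄, hsymm y₂ y₃, hsymm y₂ y₄, hsymm y₃ y₄]

theorem apply_self_le_of_norm_le (m : H →L[ℝ] H →L[ℝ] ℝ) {x : H} {r : ℝ} (hx : ‖x‖ ≤ r) :
    m x x ≤ ‖m‖ * r ^ 2 :=
  calc m x x ≤ ‖m‖ * ‖x‖ * ‖x‖ := (le_abs_self _).trans (m.le_opNorm₂ x x)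
    _ = ‖m‖ * ‖x‖ ^ 2 := by ring
    _ ≤ ‖m‖ * r ^ 2 := by gcongr

theorem norm_smul_add_smul_le {x y : H} {r r' : ℝ} (a b : ℝ) (hx : ‖x‖ ≤ r) (hy : ‖y‖ ≤ r') :
    ‖a • x + b • y‖ ≤ |a| * r + |b| * r' :=
  calc ‖a • x + b • y‖ ≤ |a| * ‖x‖ + |b| * ‖y‖ := by
        simpa [norm_smul] using norm_add_le (a • x) (b • y)
    _ ≤ _ := by gcongr

theorem bdf2Energy_le (m : H →L[ℝ] H →L[ℝ] ℝ) {y₀ y₁ : H} {r : ℝ} (h₀ : ‖y₀‖ ≤ r)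
    (h₁ : ‖y₁‖ ≤ r) : bdf2Energy m y₀ y₁ ≤ 5 * ‖m‖ * r ^ 2 := by
  have h₂ : ‖(2 : ℝ) • y₁ - y₀‖ ≤ 3 * r := by
    have := norm_smul_add_smul_le 2 (-1) h₁ h₀
    norm_num at this
    rw [sub_eq_add_neg]
    linarith
  unfold bdf2Energy
  linarith [apply_self_le_of_norm_le m h₁, apply_self_le_of_norm_le m h₂]

theorem extrapolatedEnergy_le (m : H →L[ℝ] H →L[ℝ] ℝ) {y₀ y₁ y₂ y₃ : H} {r : ℝ}
    (h₀ : ‖y₀‖ ≤ r) (h₁ : ‖y₁‖ ≤ r) (h₂ : ‖y₂‖ ≤ r) (h₃ : ‖y₃‖ ≤ r) :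
    extrapolatedEnergy m y₀ y₁ y₂ y₃ ≤ 40 * ‖m‖ * r ^ 2 := by
  have h₄ : ‖y₀ - (2 : ℝ) • y₁ + (2 : ℝ) • y₃‖ ≤ 5 * r := by
    have h := norm_smul_add_smul_le 1 2 (norm_smul_add_smul_le 1 (-2) h₀ h₁) h₃
    norm_num [← sub_eq_add_neg] at h
    linarith
  have h₅ : ‖(3 : ℝ) • y₁ - (4 : ℝ) • y₂ - (2 : ℝ) • y₃‖ ≤ 9 * r := by
    have h := norm_smul_add_smul_le 1 (-2) (norm_smul_add_smul_le 3 (-4) h₁ h₂) h₃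
    norm_num [← sub_eq_add_neg] at h
    linarith
  have h₆ : ‖(11 : ℝ) • y₂ - (14 : ℝ) • y₃‖ ≤ 25 * r := by
    have h := norm_smul_add_smul_le 11 (-14) h₂ h₃
    norm_num [← sub_eq_add_neg] at h
    linarith
  have h₇ : 0 ≤ ‖m‖ * r ^ 2 := by positivity
  unfold extrapolatedEnergy
  linarith [apply_self_le_of_norm_le m h₃, apply_self_le_of_norm_le m h₄,
    apply_self_le_of_norm_le m h₅, apply_self_le_of_norm_le m h₆]

theorem norm_sq_smul_add_smul_le {A B t : ℝ} {x y : H} (a b : ℝ) (hx : ‖x‖ ^ 2 ≤ A * t)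
    (hy : ‖y‖ ^ 2 ≤ B * t) :
    ‖a • x + b • y‖ ^ 2 ≤ (2 * (a ^ 2 * A + b ^ 2 * B)) * t := by
  have h : ‖a • x + b • y‖ ≤ |a| * ‖x‖ + |b| * ‖y‖ := by
    simpa [norm_smul] using norm_add_le (a • x) (b • y)
  calc ‖a • x + b • y‖ ^ 2 ≤ (|a| * ‖x‖ + |b| * ‖y‖) ^ 2 := by gcongr
    _ ≤ 2 * (a ^ 2 * ‖x‖ ^ 2 + b ^ 2 * ‖y‖ ^ 2) := by
      nlinarith [sq_nonneg (|a| * ‖x‖ - |b| * ‖y‖), sq_abs a, sq_abs b]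
    _ ≤ 2 * (a ^ 2 * (A * t) + b ^ 2 * (B * t)) := by gcongr
    _ = _ := by ring

/-- Young's inequality with weights chosen to spend exactly one of the two copies of τβ available in
each step. -/
theorem mul_norm_le_dissipation {B R τ β r : ℝ} (hB : 0 < B) (hτ : 0 < τ) (hβ : r ^ 2 ≤ B * β) :
    R * τ ^ 3 * r ≤ τ * β + R ^ 2 * B / 4 * τ ^ 5 := by
  have h1 : r ^ 2 / B ≤ β := by rw [div_le_iff₀ hB]; linarith
  have h2 : 0 ≤ τ / B * (r - R * B * τ ^ 2 / 2) ^ 2 := by positivity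
  have h3 : τ / B * (r - R * B * τ ^ 2 / 2) ^ 2
      = τ * (r ^ 2 / B) - R * τ ^ 3 * r + R ^ 2 * B / 4 * τ ^ 5 := by
    field_simp
    ring
  have h4 := mul_le_mul_of_nonneg_left h1 hτ.le
  linarith

/-- One step of the scheme, without cancellation in the difference quotients. -/
theorem exists_single_step_bound (c s : H →L[ℝ] H →L[ℝ] ℝ) {cc B : ℝ} (hcc : 0 < cc)
    (hB : 0 < B) (hc : ∀ p, cc * ‖p‖ ^ 2 ≤ c p p) (R A₁ A₂ : ℝ) :
    ∃ C : ℝ, 0 ≤ C ∧ ∀ τ > 0, ∀ (x w y : H) (β : ℝ), ‖y‖ ^ 2 ≤ B * β →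
      ‖x‖ ^ 2 ≤ A₁ * ((1 + τ) * τ ^ 4) → ‖w‖ ^ 2 ≤ A₂ * ((1 + τ) * τ ^ 4) →
      c ((3 : ℝ) • y - x) y + s w y + 2 * τ * β ≤ R * τ ^ 3 * ‖y‖ →
      ‖y‖ ^ 2 + τ * β ≤ C * ((1 + τ) * τ ^ 4) := by
  set D := ‖c‖ ^ 2 / (4 * cc) * |A₁| + ‖s‖ ^ 2 / (4 * cc) * |A₂| + R ^ 2 * B / 4 with hD
  have hD0 : 0 ≤ D := by positivity
  refine ⟨(1 + 1 / cc) * D, by positivity, fun τ hτ x w y β hβ hx hw h => ?_⟩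
  have hβ0 : 0 ≤ β := nonneg_of_mul_nonneg_right ((sq_nonneg _).trans hβ) hB
  -- Each off-diagonal term costs one copy of cc‖y‖². The leading 3 c(y, y) supplies three, so one
  -- is left after the terms in x and w.
  have key : ∀ (m : H →L[ℝ] H →L[ℝ] ℝ) (z : H) (A : ℝ), ‖z‖ ^ 2 ≤ A * ((1 + τ) * τ ^ 4) →
      |m z y| ≤ cc * ‖y‖ ^ 2 + ‖m‖ ^ 2 / (4 * cc) * |A| * ((1 + τ) * τ ^ 4) := by
    intro m z A hz
    have h1 : |m z y| ≤ ‖m‖ * ‖z‖ * ‖y‖ := m.le_opNorm₂ z y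
    have h2 : 0 ≤ cc * (‖y‖ - ‖m‖ * ‖z‖ / (2 * cc)) ^ 2 := by positivity
    have h3 : cc * (‖y‖ - ‖m‖ * ‖z‖ / (2 * cc)) ^ 2
        = cc * ‖y‖ ^ 2 - ‖m‖ * ‖z‖ * ‖y‖ + ‖m‖ ^ 2 / (4 * cc) * ‖z‖ ^ 2 := by
      field_simp
      ring
    have h4 : ‖m‖ ^ 2 / (4 * cc) * ‖z‖ ^ 2
        ≤ ‖m‖ ^ 2 / (4 * cc) * (|A| * ((1 + τ) * τ ^ 4)) := by
      gcongr
      exact hz.trans (mul_le_mul_of_nonneg_right (le_abs_self A) (by positivity))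
    linarith
  have h1 := (abs_le.1 (key c x A₁ hx)).2
  have h2 := (abs_le.1 (key s w A₂ hw)).1
  have h3 := mul_norm_le_dissipation (R := R) hB hτ hβ
  have h4 : R ^ 2 * B / 4 * τ ^ 5 ≤ R ^ 2 * B / 4 * ((1 + τ) * τ ^ 4) := by
    gcongr
    nlinarith [pow_pos hτ 4]
  simp only [map_sub, map_smul, sub_apply, smul_apply, smul_eq_mul] at h
  have h5 : cc * ‖y‖ ^ 2 + τ * β ≤ D * ((1 + τ) * τ ^ 4) := by
    rw [hD]
    linarith [hc y]
  have h6 : 0 ≤ τ * β := by positivity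
  have h7 : ‖y‖ ^ 2 ≤ 1 / cc * (D * ((1 + τ) * τ ^ 4)) := by
    rw [one_div, inv_mul_eq_div, le_div_iff₀ hcc]
    linarith
  have h8 : 0 ≤ cc * ‖y‖ ^ 2 := by positivity
  linarith

end Energy

/-! ### Stability of the extrapolated BDF-2 recursion -/

section EnergyEstimate

variable {H : Type*} [NormedAddCommGroup H] [NormedSpace ℝ H]

/-- The first two steps of the extrapolated BDF-2 scheme. -/
theorem exists_starting_bound (c s : H →L[ℝ] H →L[ℝ] ℝ) {cc B : ℝ} (hcc : 0 < cc)
    (hB : 0 < B) (hc : ∀ p, cc * ‖p‖ ^ 2 ≤ c p p) {R : ℝ} (hR : 0 ≤ R) :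
    ∃ C : ℝ, 0 ≤ C ∧ ∀ τ > 0, ∀ (N : ℕ) (y z Δ : ℕ → H) (β : ℕ → ℝ),
      (∀ n, ‖y n‖ ^ 2 ≤ B * β n) → y 0 = 0 → ‖y 1‖ ^ 2 ≤ R * τ ^ 4 →
      z 0 = y 0 → z 1 = y 1 → (∀ n, z (n + 2) = (2 : ℝ) • y (n + 1) - y n + Δ n) →
      (∀ n, n + 2 ≤ N → ‖Δ n‖ ≤ R * τ ^ 2) →
      (∀ n, n + 2 ≤ N → c (bdf2 y n) (y (n + 2)) + s (bdf2 z n) (y (n + 2)) + 2 * τ * β (n + 2)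
        ≤ R * τ ^ 3 * ‖y (n + 2)‖) →
      (2 ≤ N → ‖y 2‖ ^ 2 + τ * β 2 ≤ C * ((1 + τ) * τ ^ 4)) ∧
      (3 ≤ N → ‖y 3‖ ^ 2 + τ * β 3 ≤ C * ((1 + τ) * τ ^ 4)) := by
  -- The constants have the shape produced by `norm_sq_smul_add_smul_le` for the known terms of the
  -- step; the term 0 • y 1 below only pads a single vector to this shape. The crude bounds carry no
  -- extra power of τ, which is harmless because they are used for just two steps.
  obtain ⟨C₂, hC₂, h₂⟩ := exists_single_step_bound c s hcc hB hc R
    (2 * (4 ^ 2 * R + 0 ^ 2 * R)) (2 * (2 ^ 2 * R + 3 ^ 2 * R ^ 2))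
  obtain ⟨C₃, hC₃, h₃⟩ := exists_single_step_bound c s hcc hB hc R
    (2 * (4 ^ 2 * C₂ + (-1) ^ 2 * R))
    (2 * (1 ^ 2 * (2 * (6 ^ 2 * C₂ + (-10) ^ 2 * R))
      + 1 ^ 2 * (2 * (3 ^ 2 * R ^ 2 + (-4) ^ 2 * R ^ 2))))
  refine ⟨C₂ + C₃, by positivity, fun τ hτ N y z Δ β hβ hy0 hy1 hz0 hz1 hz hΔ heq => ?_⟩
  have ht : τ ^ 4 ≤ (1 + τ) * τ ^ 4 := by nlinarith [pow_pos hτ 4]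
  have ht0 : 0 ≤ (1 + τ) * τ ^ 4 := by positivity
  have hb1 : ‖y 1‖ ^ 2 ≤ R * ((1 + τ) * τ ^ 4) := hy1.trans (by gcongr)
  have hbΔ : ∀ n, n + 2 ≤ N → ‖Δ n‖ ^ 2 ≤ R ^ 2 * ((1 + τ) * τ ^ 4) := fun n hn =>
    calc ‖Δ n‖ ^ 2 ≤ (R * τ ^ 2) ^ 2 := by gcongr; exact hΔ n hn
      _ = R ^ 2 * τ ^ 4 := by ring
      _ ≤ _ := by gcongr
  have hβ0 : ∀ n, 0 ≤ τ * β n := fun n =>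
    mul_nonneg hτ.le (nonneg_of_mul_nonneg_right ((sq_nonneg _).trans (hβ n)) hB)
  have step2 : 2 ≤ N → ‖y 2‖ ^ 2 + τ * β 2 ≤ C₂ * ((1 + τ) * τ ^ 4) := by
    intro hN
    have hby : bdf2 y 0 = (3 : ℝ) • y 2 - ((4 : ℝ) • y 1 + (0 : ℝ) • y 1) := by
      simp only [bdf2, zero_add, hy0]; module
    have hbz : bdf2 z 0 = (2 : ℝ) • y 1 + (3 : ℝ) • Δ 0 := by
      simp only [bdf2, hz 0, hz0, hz1, zero_add, hy0]; module
    have h := heq 0 hN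
    rw [hby, hbz] at h
    refine h₂ τ hτ ((4 : ℝ) • y 1 + (0 : ℝ) • y 1) ((2 : ℝ) • y 1 + (3 : ℝ) • Δ 0) (y 2) (β 2)
      (hβ 2) (norm_sq_smul_add_smul_le _ _ hb1 hb1)
      (norm_sq_smul_add_smul_le _ _ hb1 (hbΔ 0 hN)) h
  have step3 : 3 ≤ N → ‖y 3‖ ^ 2 + τ * β 3 ≤ C₃ * ((1 + τ) * τ ^ 4) := by
    intro hN
    have hb2 : ‖y 2‖ ^ 2 ≤ C₂ * ((1 + τ) * τ ^ 4) := by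
      linarith [step2 (by omega), hβ0 2]
    have hby : bdf2 y 1 = (3 : ℝ) • y 3 - ((4 : ℝ) • y 2 + (-1 : ℝ) • y 1) := by
      simp only [bdf2, Nat.reduceAdd]; module
    have hbz : bdf2 z 1 = (1 : ℝ) • ((6 : ℝ) • y 2 + (-10 : ℝ) • y 1)
        + (1 : ℝ) • ((3 : ℝ) • Δ 1 + (-4 : ℝ) • Δ 0) := by
      simp only [bdf2, hz 0, hz 1, hz1, Nat.reduceAdd, zero_add, hy0]; module
    have h := heq 1 hN
    rw [hby, hbz] at h
    refine h₃ τ hτ ((4 : ℝ) • y 2 + (-1 : ℝ) • y 1)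
      ((1 : ℝ) • ((6 : ℝ) • y 2 + (-10 : ℝ) • y 1) + (1 : ℝ) • ((3 : ℝ) • Δ 1 + (-4 : ℝ) • Δ 0))
      (y 3) (β 3) (hβ 3) (norm_sq_smul_add_smul_le _ _ hb2 hb1)
      (norm_sq_smul_add_smul_le _ _ (norm_sq_smul_add_smul_le _ _ hb2 hb1)
        (norm_sq_smul_add_smul_le _ _ (hbΔ 1 hN) (hbΔ 0 (by omega)))) h
  constructor
  · intro hN
    nlinarith [step2 hN, mul_nonneg hC₃ ht0]
  · intro hN
    nlinarith [step3 hN, mul_nonneg hC₂ ht0]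

/-- Stability of the BDF-2 scheme with extrapolated coupling, for a coupling of strength at most
`1 / 5`. -/
theorem exists_energy_estimate (c s : H →L[ℝ] H →L[ℝ] ℝ) {cc B : ℝ} (hcc : 0 < cc)
    (hB : 0 < B) (hc : ∀ p, cc * ‖p‖ ^ 2 ≤ c p p) (hcsymm : ∀ p q, c p q = c q p)
    (hssymm : ∀ p q, s p q = s q p) (hs : ∀ p, 0 ≤ s p p) (hsc : ∀ p, 5 * s p p ≤ c p p)
    {R : ℝ} (hR : 0 ≤ R) :
    ∃ C : ℝ, 0 ≤ C ∧ ∀ τ > 0, ∀ (N : ℕ) (y z Δ : ℕ → H) (β : ℕ → ℝ),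
      (∀ n, ‖y n‖ ^ 2 ≤ B * β n) → y 0 = 0 → ‖y 1‖ ^ 2 ≤ R * τ ^ 4 →
      z 0 = y 0 → z 1 = y 1 → (∀ n, z (n + 2) = (2 : ℝ) • y (n + 1) - y n + Δ n) →
      (∀ n, n + 2 ≤ N → ‖Δ n‖ ≤ R * τ ^ 2) →
      (∀ n, n + 3 ≤ N → ‖Δ (n + 1) - Δ n‖ ≤ R * τ ^ 3) →
      (∀ n, n + 2 ≤ N → c (bdf2 y n) (y (n + 2)) + s (bdf2 z n) (y (n + 2)) + 2 * τ * β (n + 2)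
        ≤ R * τ ^ 3 * ‖y (n + 2)‖) →
      ∀ n ≤ N, ‖y n‖ ^ 2 + τ * ∑ j ∈ Finset.Icc 2 n, β j ≤ C * ((1 + n * τ) * τ ^ 4) := by
  obtain ⟨C₁, hC₁, hstart⟩ := exists_starting_bound c s hcc hB hc hR
  -- The subtracted 3s is what the extrapolated energy needs; 5s ≤ c leaves m ≥ (2/5)c.
  set m : H →L[ℝ] H →L[ℝ] ℝ := c - (3 : ℝ) • s with hm_def
  have hm_apply : ∀ p q, m p q = c p q - 3 * s p q := fun p q => by simp [m]
  have hm_symm : ∀ p q, m p q = m q p := fun p q => by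
    rw [hm_apply, hm_apply, hcsymm p q, hssymm p q]
  have hm_lower : ∀ p, 2 / 5 * cc * ‖p‖ ^ 2 ≤ m p p := fun p => by
    rw [hm_apply]; linarith [hsc p, hc p]
  have hm_nonneg : ∀ p, 0 ≤ m p p := fun p => le_trans (by positivity) (hm_lower p)
  set R' := R + 4 * ‖s‖ * R with hR'
  set C₂ := R' ^ 2 * B / 4 with hC₂
  set C₃ := (5 * ‖m‖ + 40 * ‖s‖) * (R + C₁) with hC₃
  have hC₂0 : 0 ≤ C₂ := by positivity
  have hC₃0 : 0 ≤ C₃ := by positivity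
  refine ⟨(1 + 5 / cc) * (C₂ + C₃) + 2 * C₁ + R, by positivity,
    fun τ hτ N y z Δ β hβ hy0 hy1 hz0 hz1 hz hΔ hΔ' heq => ?_⟩
  obtain ⟨hb2, hb3⟩ := hstart τ hτ N y z Δ β hβ hy0 hy1 hz0 hz1 hz hΔ heq
  have hβ0 : ∀ n, 0 ≤ β n := fun n => nonneg_of_mul_nonneg_right ((sq_nonneg _).trans (hβ n)) hB
  -- The window has four levels, so the first increment reaches y₄. This is also the first step
  -- whose BDF₂ z involves only extrapolated values, since z₀ and z₁ are not extrapolated.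
  set F : ℕ → ℝ := fun k => bdf2Energy m (y (k + 2)) (y (k + 3))
    + extrapolatedEnergy s (y k) (y (k + 1)) (y (k + 2)) (y (k + 3)) with hF
  have hstep : ∀ k, k + 4 ≤ N → F (k + 1) + τ * β (k + 4) ≤ F k + C₂ * τ ^ 5 := by
    intro k hk
    have e1 := bdf2Energy_sub_le hm_symm hm_nonneg (y (k + 2)) (y (k + 3)) (y (k + 4))
    have e2 := extrapolatedEnergy_sub_le hssymm hs (y k) (y (k + 1)) (y (k + 2)) (y (k + 3))
      (y (k + 4))
    have e3 := heq (k + 2) hk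
    -- The weights 3, -4, 1 of Δ sum to zero, so only differences of Δ enter; these are third
    -- differences of the pressure and gain a power of τ.
    have hzk : bdf2 z (k + 2) = ((6 : ℝ) • y (k + 3) - (11 : ℝ) • y (k + 2) + (6 : ℝ) • y (k + 1)
        - y k) + ((3 : ℝ) • (Δ (k + 1 + 1) - Δ (k + 1)) + (-1 : ℝ) • (Δ (k + 1) - Δ k)) := by
      simp only [bdf2, hz]
      simp only [Nat.add_assoc, Nat.reduceAdd]
      module
    have hres := norm_smul_add_smul_le 3 (-1) (hΔ' (k + 1) hk) (hΔ' k (by omega))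
    norm_num at hres
    set D := (3 : ℝ) • (Δ (k + 1 + 1) - Δ (k + 1)) + (-1 : ℝ) • (Δ (k + 1) - Δ k) with hD
    have hD' : ‖D‖ ≤ 4 * R * τ ^ 3 := by
      rw [hD]; norm_num; linarith
    have e4 : -(‖s‖ * (4 * R * τ ^ 3) * ‖y (k + 4)‖) ≤ s D (y (k + 4)) := by
      refine le_trans (neg_le_neg ?_) (neg_abs_le _)
      exact (s.le_opNorm₂ _ _).trans (by gcongr)
    have e5 := mul_norm_le_dissipation (R := R') hB hτ (hβ (k + 4))
    rw [hzk, map_add, add_apply] at e3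
    simp only [bdf2, show k + 2 + 2 = k + 4 by ring, show k + 2 + 1 = k + 3 by ring] at e3
    rw [hm_apply] at e1
    rw [← hC₂] at e5
    have e6 : R' * τ ^ 3 * ‖y (k + 4)‖
        = R * τ ^ 3 * ‖y (k + 4)‖ + ‖s‖ * (4 * R * τ ^ 3) * ‖y (k + 4)‖ := by rw [hR']; ring
    simp only [hF, show k + 1 + 2 = k + 3 by ring, show k + 1 + 3 = k + 4 by ring,
      show k + 1 + 1 = k + 2 by ring]
    linarith
  have hsum : ∀ k, k + 3 ≤ N →
      F k + τ * ∑ j ∈ Finset.Icc 4 (k + 3), β j ≤ F 0 + k * τ * (C₂ * τ ^ 4) := by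
    intro k
    induction k with
    | zero => intro _; simp
    | succ k ih =>
      intro hk
      have h1 := ih (by omega)
      have h2 := hstep k (by omega)
      rw [show k + 1 + 3 = k + 3 + 1 by ring, Finset.sum_Icc_succ_top (by omega)]
      push_cast
      linarith
  have hnorm : ∀ x : H, ∀ A t : ℝ, ‖x‖ ^ 2 ≤ A * t → ‖x‖ ≤ Real.sqrt (A * t) := fun x A t h =>
    Real.le_sqrt_of_sq_le h
  intro n hn
  have hT1 : τ ^ 4 ≤ (1 + n * τ) * τ ^ 4 := by
    have : 0 ≤ n * τ * τ ^ 4 := by positivity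
    linarith
  set t := (1 + n * τ) * τ ^ 4 with ht
  have ht0 : 0 ≤ t := by positivity
  have hT2 : 1 ≤ n → (1 + τ) * τ ^ 4 ≤ t := by
    intro h
    have h1 : (1 : ℝ) ≤ n := by exact_mod_cast h
    have h2 : 1 + τ ≤ 1 + n * τ := by nlinarith
    rw [ht]
    gcongr
  have hyR : ‖y 1‖ ^ 2 ≤ R * t := hy1.trans (by gcongr)
  have hfac : 0 ≤ (1 + 5 / cc) * (C₂ + C₃) * t := by positivity
  have hC₁t : 0 ≤ C₁ * t := by positivity
  have hRt : 0 ≤ R * t := by positivity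
  rcases n with _ | _ | _ | k
  · simp only [hy0, norm_zero, ne_eq, OfNat.ofNat_ne_zero, not_false_eq_true, zero_pow, zero_add]
    rw [Finset.Icc_eq_empty (by omega), Finset.sum_empty]
    linarith
  · rw [Finset.Icc_eq_empty (by omega), Finset.sum_empty]
    simp only [zero_add]
    linarith
  · have h1 := (hb2 hn).trans (mul_le_mul_of_nonneg_left (hT2 (by omega)) hC₁)
    simp only [zero_add, Nat.reduceAdd, Finset.Icc_self, Finset.sum_singleton]
    linarith
  · have h2 := (hb2 (by omega)).trans (mul_le_mul_of_nonneg_left (hT2 (by omega)) hC₁)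
    have h3 := (hb3 (by omega)).trans (mul_le_mul_of_nonneg_left (hT2 (by omega)) hC₁)
    have hA : ∀ j < 4, ‖y j‖ ≤ Real.sqrt ((R + C₁) * t) := by
      intro j hj
      refine hnorm _ _ _ ?_
      have p2 := mul_nonneg hτ.le (hβ0 2)
      have p3 := mul_nonneg hτ.le (hβ0 3)
      interval_cases j
      · rw [hy0]; simp only [norm_zero]; nlinarith
      · linarith
      · linarith
      · linarith
    have hF0 : F 0 ≤ C₃ * t := by
      have e1 := bdf2Energy_le m (hA 2 (by norm_num)) (hA 3 (by norm_num))
      have e2 := extrapolatedEnergy_le s (hA 0 (by norm_num)) (hA 1 (by norm_num))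
        (hA 2 (by norm_num)) (hA 3 (by norm_num))
      rw [Real.sq_sqrt (by positivity)] at e1 e2
      simp only [hF, zero_add, hC₃]
      linarith
    have hk := hsum k (by omega)
    have hkt : k * τ * (C₂ * τ ^ 4) ≤ C₂ * t := by
      have : 0 ≤ (1 + 3 * τ) * (C₂ * τ ^ 4) := by positivity
      rw [ht]
      push_cast
      linarith
    have hlow : cc / 5 * ‖y (k + 3)‖ ^ 2 ≤ F k := by
      have e1 := half_apply_le_bdf2Energy hm_nonneg (y (k + 2)) (y (k + 3))
      have e2 := extrapolatedEnergy_nonneg hs (y k) (y (k + 1)) (y (k + 2)) (y (k + 3))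
      have e3 := hm_lower (y (k + 3))
      simp only [hF]
      linarith
    have hS : 0 ≤ τ * ∑ j ∈ Finset.Icc 4 (k + 3), β j :=
      mul_nonneg hτ.le (Finset.sum_nonneg fun j _ => hβ0 j)
    have hsplit : ∑ j ∈ Finset.Icc 2 (k + 3), β j
        = β 2 + β 3 + ∑ j ∈ Finset.Icc 4 (k + 3), β j := by
      rw [← Finset.add_sum_Ioc_eq_sum_Icc (by omega), ← Finset.Icc_add_one_left_eq_Ioc,
        ← Finset.add_sum_Ioc_eq_sum_Icc (by omega), ← Finset.Icc_add_one_left_eq_Ioc]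
      norm_num [add_assoc]
    have hy : ‖y (k + 3)‖ ^ 2 ≤ 5 / cc * ((C₂ + C₃) * t) := by
      rw [div_mul_eq_mul_div, le_div_iff₀ hcc]
      linarith
    have hcc5 : 0 ≤ cc / 5 * ‖y (k + 3)‖ ^ 2 := by positivity
    rw [show k + 1 + 1 + 1 = k + 3 by ring, hsplit]
    linarith [sq_nonneg ‖y 2‖, sq_nonneg ‖y 3‖]

end EnergyEstimate

/-! ### Solvability of coercive problems -/

section LaxMilgram

variable {V H : Type*} [NormedAddCommGroup V] [InnerProductSpace ℝ V]
  [NormedAddCommGroup H] [NormedSpace ℝ H]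

theorem isCoercive_of_le {B : V →L[ℝ] V →L[ℝ] ℝ} {α : ℝ} (hα : 0 < α)
    (hB : ∀ u, α * ‖u‖ ^ 2 ≤ B u u) : IsCoercive B :=
  ⟨α, hα, fun u => by rw [mul_assoc, ← sq]; exact hB u⟩

/-- The solution operator of a family of coercive problems with a bounded family of data. -/
theorem IsCoercive.exists_solution_operator [CompleteSpace V] {B : V →L[ℝ] V →L[ℝ] ℝ}
    (hB : IsCoercive B) (ℓ : H →L[ℝ] V →L[ℝ] ℝ) :
    ∃ L : H →L[ℝ] V, ∀ z v, B (L z) v = ℓ z v := by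
  -- The inverse Riesz map is conjugate-linear; over ℝ it is repackaged as a linear map.
  let J : (V →L[ℝ] ℝ) →ₗ[ℝ] V :=
    { toFun := (InnerProductSpace.toDual ℝ V).symm
      map_add' := map_add _
      map_smul' := fun r x => by simp }
  refine ⟨(hB.continuousLinearEquivOfBilin.symm : V →L[ℝ] V).comp
    ((J.mkContinuous 1 fun x => by simp [J]).comp ℓ), fun z v => ?_⟩
  rw [← hB.continuousLinearEquivOfBilin_apply]
  simp [J]

theorem IsCoercive.exists_solution [CompleteSpace V] {B : V →L[ℝ] V →L[ℝ] ℝ}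
    (hB : IsCoercive B) (ℓ : V →L[ℝ] ℝ) : ∃ u, ∀ v, B u v = ℓ v := by
  obtain ⟨L, hL⟩ := hB.exists_solution_operator (ContinuousLinearMap.id ℝ (V →L[ℝ] ℝ))
  exact ⟨L ℓ, hL ℓ⟩

theorem eq_of_forall_apply_eq {B : V →L[ℝ] V →L[ℝ] ℝ} {α : ℝ} (hα : 0 < α)
    (hB : ∀ u, α * ‖u‖ ^ 2 ≤ B u u) {u u' : V} (h : ∀ v, B u v = B u' v) : u = u' := by
  have h1 := hB (u - u')
  have h0 : B (u - u') (u - u') = 0 := by rw [map_sub B, sub_apply, h, sub_self]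
  have h2 : ‖u - u'‖ ^ 2 ≤ 0 := by
    by_contra hcon
    nlinarith [mul_pos hα (not_le.1 hcon)]
  exact sub_eq_zero.1 (norm_eq_zero.1 (pow_eq_zero_iff two_ne_zero |>.1
    (le_antisymm h2 (sq_nonneg _))))

end LaxMilgram

theorem exists_seq_of_forall_exists_next {α : Type*} {r : ℕ → α → α → α → Prop}
    (h : ∀ n a b, ∃ c, r n a b c) (a b : α) :
    ∃ x : ℕ → α, x 0 = a ∧ x 1 = b ∧ ∀ n, r n (x n) (x (n + 1)) (x (n + 2)) := by
  choose F hF using h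
  let s : ℕ → α × α := fun n => Nat.rec (a, b) (fun n q => (q.2, F n q.1 q.2)) n
  exact ⟨fun n => (s n).1, rfl, rfl, fun n => hF n (s n).1 (s n).2⟩

/-! ### Error equations, solvability and convergence of the scheme -/

namespace EllipticParabolicForms

variable {V H Q : Type*}
  [NormedAddCommGroup V] [InnerProductSpace ℝ V]
  [NormedAddCommGroup H] [InnerProductSpace ℝ H]
  [NormedAddCommGroup Q] [InnerProductSpace ℝ Q]

section ErrorEquations

variable {S : EllipticParabolicForms V H Q} {T K τ : ℝ} {N : ℕ} {f : ℝ → V →L[ℝ] ℝ}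
  {g : ℝ → Q →L[ℝ] ℝ} {u : ℝ → V} {p : ℝ → Q} {p₀ p₁ : Q} {un w : ℕ → V} {pn e : ℕ → Q}

theorem mul_mem_Icc_of_le (hτ : 0 < τ) (hN : (N : ℝ) * τ = T) {n : ℕ} (hn : n ≤ N) :
    (n : ℝ) * τ ∈ Icc 0 T :=
  ⟨by positivity, by rw [← hN]; gcongr⟩

/-- The exact pressure at tⁿ⁺² is its own extrapolation plus a second difference, which is the only
defect of the lagged elliptic equation. -/
theorem IsSemiExplicit.error_elliptic (hsol : S.IsSolution T f g u p)
    (hsch : S.IsSemiExplicit τ N f g p₀ p₁ un pn) (hτ : 0 < τ) (hN : (N : ℝ) * τ = T)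
    (hw : ∀ n, w n = u (n * τ) - un n) (he : ∀ n, e n = p (n * τ) - pn n) {n : ℕ}
    (hn : n + 2 ≤ N) (v : V) :
    S.a (w (n + 2)) v = S.d v ((2 : ℝ) • S.ι (e (n + 1)) - S.ι (e n)
      + (S.ι (p (n * τ + 2 * τ)) - (2 : ℝ) • S.ι (p (n * τ + τ)) + S.ι (p (n * τ)))) := by
  have h1 := hsol.elliptic _ (mul_mem_Icc_of_le hτ hN hn) v
  have h2 := hsch.step_u n hn v
  have ht1 : ((n + 1 : ℕ) : ℝ) * τ = n * τ + τ := by push_cast; ring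
  have ht2 : ((n + 2 : ℕ) : ℝ) * τ = n * τ + 2 * τ := by push_cast; ring
  rw [ht2] at h1 h2
  rw [hw, he, he, ht1, ht2]
  simp only [map_sub, sub_apply, map_add, map_smul, smul_eq_mul] at h2 ⊢
  linarith

/-- Both parabolic equations are tested with the new pressure error and multiplied by 2τ; the data g
cancel and only the two BDF-2 consistency errors remain. -/
theorem IsSemiExplicit.error_parabolic (hsol : S.IsSolution T f g u p)
    (hsch : S.IsSemiExplicit τ N f g p₀ p₁ un pn) (hT : 0 < T) (hu : C3BoundedBy T K u)
    (hp : C3BoundedBy T K (fun t => S.ι (p t))) (hτ : 0 < τ) (hN : (N : ℝ) * τ = T)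
    (hw : ∀ n, w n = u (n * τ) - un n) (he : ∀ n, e n = p (n * τ) - pn n) {n : ℕ}
    (hn : n + 2 ≤ N) :
    S.c (S.ι (bdf2 e n)) (S.ι (e (n + 2))) + S.d (bdf2 w n) (S.ι (e (n + 2)))
      + 2 * τ * S.b (e (n + 2)) (e (n + 2))
      ≤ 36 * K * (‖S.d‖ + ‖S.c‖) * τ ^ 3 * ‖S.ι (e (n + 2))‖ := by
  have hmem := mul_mem_Icc_of_le hτ hN hn
  have h1 := hsol.parabolic (((n + 2 : ℕ) : ℝ) * τ) ⟨by positivity, hmem.2⟩ (e (n + 2))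
  have h2 := hsch.step_p n hn (e (n + 2))
  have ht1 : ((n + 1 : ℕ) : ℝ) * τ = n * τ + τ := by push_cast; ring
  have ht2 : ((n + 2 : ℕ) : ℝ) * τ = n * τ + 2 * τ := by push_cast; ring
  rw [ht2] at h1 h2 hmem
  have hru := hu.norm_bdf2_consistency_le hT (x := n * τ) (by positivity) hτ.le hmem.2
  have hrp := hp.norm_bdf2_consistency_le hT (x := n * τ) (by positivity) hτ.le hmem.2
  set u' := derivWithin u (Icc 0 T) (n * τ + 2 * τ)
  set p' := derivWithin (fun t => S.ι (p t)) (Icc 0 T) (n * τ + 2 * τ)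
  set ρu := (3 : ℝ) • u (n * τ + 2 * τ) - (4 : ℝ) • u (n * τ + τ) + u (n * τ) - (2 * τ) • u'
    with hρu
  set ρp := (3 : ℝ) • S.ι (p (n * τ + 2 * τ)) - (4 : ℝ) • S.ι (p (n * τ + τ))
    + S.ι (p (n * τ)) - (2 * τ) • p' with hρp
  have hwu : bdf2 w n = ρu + (2 * τ) • u' - bdf2 un n := by
    rw [bdf2, bdf2, hw, hw, hw, hρu, ht1, ht2]; module
  have hyp : S.ι (bdf2 e n) = ρp + (2 * τ) • p' - S.ι (bdf2 pn n) := by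
    rw [bdf2, bdf2, he, he, he, hρp, ht1, ht2]
    simp only [map_add, map_sub, map_smul]
    module
  have hbe : S.b (e (n + 2)) (e (n + 2))
      = S.b (p (n * τ + 2 * τ)) (e (n + 2)) - S.b (pn (n + 2)) (e (n + 2)) := by
    rw [← sub_apply, ← map_sub, ← ht2, ← he]
  have hid : S.c (S.ι (bdf2 e n)) (S.ι (e (n + 2))) + S.d (bdf2 w n) (S.ι (e (n + 2)))
      + 2 * τ * S.b (e (n + 2)) (e (n + 2))
      = S.c ρp (S.ι (e (n + 2))) + S.d ρu (S.ι (e (n + 2))) := by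
    rw [hwu, hyp, hbe, map_sub S.c, map_add S.c, map_smul S.c, map_sub S.d, map_add S.d,
      map_smul S.d]
    simp only [add_apply, sub_apply, smul_apply, smul_eq_mul]
    have h3 : 2 * τ * (1 / (2 * τ)) = 1 := by field_simp
    linear_combination 2 * τ * h1 - 2 * τ * h2
      + (S.d (bdf2 un n) (S.ι (e (n + 2))) + S.c (S.ι (bdf2 pn n)) (S.ι (e (n + 2)))) * h3
  have b1 : S.c ρp (S.ι (e (n + 2))) ≤ ‖S.c‖ * (36 * K * τ ^ 3) * ‖S.ι (e (n + 2))‖ :=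
    (le_abs_self _).trans ((S.c.le_opNorm₂ _ _).trans (by gcongr))
  have b2 : S.d ρu (S.ι (e (n + 2))) ≤ ‖S.d‖ * (36 * K * τ ^ 3) * ‖S.ι (e (n + 2))‖ :=
    (le_abs_self _).trans ((S.d.le_opNorm₂ _ _).trans (by gcongr))
  rw [hid]
  linarith

end ErrorEquations

variable [CompleteSpace V] [CompleteSpace Q]

/-- Each step decouples into two coercive problems: `a` for the displacement, where only old
pressures enter, and then b + 3/(2τ) c on `Q` for the pressure. -/
theorem exists_isSemiExplicit (S : EllipticParabolicForms V H Q) {ca cb : ℝ}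
    (hca : 0 < ca) (hcb : 0 < cb) (ha : ∀ u, ca * ‖u‖ ^ 2 ≤ S.a u u)
    (hb : ∀ p, cb * ‖p‖ ^ 2 ≤ S.b p p) (hc : ∀ p, 0 ≤ S.c p p) {τ : ℝ} (hτ : 0 < τ) (N : ℕ)
    (f : ℝ → V →L[ℝ] ℝ) (g : ℝ → Q →L[ℝ] ℝ) (p₀ p₁ : Q) :
    ∃ (un : ℕ → V) (pn : ℕ → Q), S.IsSemiExplicit τ N f g p₀ p₁ un pn := by
  have hA := (isCoercive_of_le hca ha).exists_solution
  set B : Q →L[ℝ] Q →L[ℝ] ℝ := S.b + (3 / (2 * τ)) • S.c.bilinearComp S.ι S.ι with hBdef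
  have hBapply : ∀ p q, B p q = S.b p q + 3 / (2 * τ) * S.c (S.ι p) (S.ι q) := fun p q => by
    simp [B]
  have hB := (isCoercive_of_le (B := B) hcb (fun p => by
    have := mul_nonneg (by positivity : 0 ≤ 3 / (2 * τ)) (hc (S.ι p))
    rw [hBapply]
    linarith [hb p])).exists_solution
  obtain ⟨u₀, hu₀⟩ := hA (S.d.flip (S.ι p₀) + f 0)
  obtain ⟨u₁, hu₁⟩ := hA (S.d.flip (S.ι p₁) + f τ)
  obtain ⟨x, hx0, hx1, hx⟩ := exists_seq_of_forall_exists_next (α := V × Q)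
    (r := fun n x y z =>
      (∀ v, S.a z.1 v - S.d v (S.ι ((2 : ℝ) • y.2 - x.2)) = f (((n + 2 : ℕ) : ℝ) * τ) v) ∧
      ∀ q, 1 / (2 * τ) * S.d ((3 : ℝ) • z.1 - (4 : ℝ) • y.1 + x.1) (S.ι q)
        + 1 / (2 * τ) * S.c (S.ι ((3 : ℝ) • z.2 - (4 : ℝ) • y.2 + x.2)) (S.ι q)
        + S.b z.2 q = g (((n + 2 : ℕ) : ℝ) * τ) q)
    (fun n x y => by
      obtain ⟨u, hu⟩ := hA (S.d.flip (S.ι ((2 : ℝ) • y.2 - x.2)) + f (((n + 2 : ℕ) : ℝ) * τ))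
      obtain ⟨p, hp⟩ := hB (g (((n + 2 : ℕ) : ℝ) * τ)
        - (1 / (2 * τ)) • (S.d ((3 : ℝ) • u - (4 : ℝ) • y.1 + x.1)).comp S.ι
        - (1 / (2 * τ)) • (S.c (S.ι (x.2 - (4 : ℝ) • y.2))).comp S.ι)
      refine ⟨(u, p), fun v => ?_, fun q => ?_⟩
      · rw [hu v]
        simp
      · have h := hp q
        rw [hBapply] at h
        simp only [sub_apply, smul_apply, ContinuousLinearMap.comp_apply, smul_eq_mul, map_sub,
          map_add, map_smul, add_apply] at h ⊢
        linear_combination h)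
    (u₀, p₀) (u₁, p₁)
  refine ⟨fun n => (x n).1, fun n => (x n).2, ⟨by simp [hx0], by simp [hx1], fun v => ?_,
    fun v => ?_, fun n _ => (hx n).1, fun n _ => (hx n).2⟩⟩
  · simp [hx0, hu₀ v]
  · simp [hx1, hu₁ v]

/-- The semi-explicit scheme converges with second order if the coupling is weak, the strength of
the coupling being measured in the norms induced by the forms `a` and `c`. -/
theorem secondOrderConvergence (S : EllipticParabolicForms V H Q) {ca cb cc : ℝ}
    (hca : 0 < ca) (hcb : 0 < cb) (hcc : 0 < cc)
    (hasymm : ∀ u v, S.a u v = S.a v u) (ha : ∀ u, ca * ‖u‖ ^ 2 ≤ S.a u u)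
    (hb : ∀ p, cb * ‖p‖ ^ 2 ≤ S.b p p)
    (hcsymm : ∀ p q, S.c p q = S.c q p) (hc : ∀ p, cc * ‖p‖ ^ 2 ≤ S.c p p)
    (hd : ∀ u p, 5 * S.d u p ^ 2 ≤ S.a u u * S.c p p) :
    S.SecondOrderConvergence := by
  intro K
  have hc0 : ∀ p, 0 ≤ S.c p p := fun p => le_trans (by positivity) (hc p)
  obtain ⟨L, hL⟩ := (isCoercive_of_le hca ha).exists_solution_operator S.d.flip
  replace hL : ∀ z v, S.a (L z) v = S.d v z := hL
  set s : H →L[ℝ] H →L[ℝ] ℝ := S.d.comp L with hs_def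
  have hs_apply : ∀ p q, s p q = S.d (L p) q := fun p q => rfl
  have hs_a : ∀ p q, s p q = S.a (L q) (L p) := fun p q => (hL q (L p)).symm
  have hs_symm : ∀ p q, s p q = s q p := fun p q => by rw [hs_a, hs_a, hasymm]
  have hs_nonneg : ∀ p, 0 ≤ s p p := fun p => by
    rw [hs_a]; exact le_trans (by positivity) (ha _)
  -- The coupling bound at (Lp, p) reads 5 s(p, p)² ≤ s(p, p) c(p, p); divide by s(p, p) unless it
  -- vanishes.
  have hs_c : ∀ p, 5 * s p p ≤ S.c p p := fun p => by
    have h := hd (L p) p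
    rw [← hs_a, ← hs_apply] at h
    rcases (hs_nonneg p).eq_or_lt with h0 | h0
    · rw [← h0, mul_zero]; exact hc0 p
    · nlinarith
  -- The summand 1 keeps `B` positive even when ι = 0.
  set B : ℝ := (‖S.ι‖ ^ 2 + 1) / cb with hB_def
  have hB : 0 < B := by positivity
  -- One size for all data: it dominates K, the difference constants 6K and 54K, and the consistency
  -- constant. The absolute value is needed because the final constant is fixed before any solution
  -- shows K ≥ 0.
  set R : ℝ := |K| * (60 + 36 * (‖S.d‖ + ‖S.c‖)) with hR_def
  have hR : 0 ≤ R := by positivity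
  obtain ⟨C, hC, hest⟩ := exists_energy_estimate S.c s hcc hB hc hcsymm hs_symm hs_nonneg hs_c hR
  refine ⟨‖L‖ ^ 2 * (2 * (1 ^ 2 * (2 * (2 ^ 2 * C + (-1) ^ 2 * C)) + 1 ^ 2 * R ^ 2) + C)
    + C + |K| + 1 / cb * C,
    fun T hT f g u p hsol hu hp τ N hτ hN p₁ hp₁ =>
      ⟨exists_isSemiExplicit S hca hcb ha hb hc0 hτ N f g (p 0) p₁, fun un pn hsch => ?_⟩⟩
  have hK : 0 ≤ K := hu.nonneg hT
  have hKabs : |K| = K := abs_of_nonneg hK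
  rw [hKabs] at hR_def ⊢
  have hN1 : 1 ≤ N := by
    rcases Nat.eq_zero_or_pos N with h | h
    · rw [h] at hN; simp at hN; exact absurd hN hT.ne
    · exact h
  have hmem : ∀ n ≤ N, ((n : ℕ) : ℝ) * τ ∈ Icc 0 T := fun n hn =>
    ⟨by positivity, by rw [← hN]; gcongr⟩
  set e : ℕ → Q := fun n => p (n * τ) - pn n with he
  set w : ℕ → V := fun n => u (n * τ) - un n with hw
  set y : ℕ → H := fun n => S.ι (e n) with hy
  set Δ : ℕ → H := fun n => S.ι (p (n * τ + 2 * τ)) - (2 : ℝ) • S.ι (p (n * τ + τ))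
    + S.ι (p (n * τ)) with hΔ
  have ht1 : ∀ n : ℕ, ((n + 1 : ℕ) : ℝ) * τ = n * τ + τ := fun n => by push_cast; ring
  have ht2 : ∀ n : ℕ, ((n + 2 : ℕ) : ℝ) * τ = n * τ + 2 * τ := fun n => by push_cast; ring
  have ht3 : ∀ n : ℕ, ((n + 3 : ℕ) : ℝ) * τ = n * τ + 3 * τ := fun n => by push_cast; ring
  -- The sequence obeys its recursion for every n, whereas the scheme constrains the iterates only
  -- up to `N`; hence w = Lz is claimed only there.
  obtain ⟨z, hz0, hz1, hz⟩ : ∃ z : ℕ → H, z 0 = y 0 ∧ z 1 = y 1 ∧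
      ∀ n, z (n + 2) = (2 : ℝ) • y (n + 1) - y n + Δ n :=
    exists_seq_of_forall_exists_next (r := fun n _ _ x => x = (2 : ℝ) • y (n + 1) - y n + Δ n)
      (fun n _ _ => ⟨_, rfl⟩) (y 0) (y 1)
  have hwz : ∀ n ≤ N, w n = L (z n) := by
    intro n hn
    refine eq_of_forall_apply_eq hca ha fun v => ?_
    rw [hL]
    rcases n with _ | _ | n
    · have h1 := hsol.elliptic _ (hmem 0 hn) v
      have h2 := hsch.u_zero v
      simp only [Nat.cast_zero, zero_mul] at h1
      simp only [hw, hz0, hy, he, map_sub, sub_apply, Nat.cast_zero, zero_mul]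
      linarith
    · have h1 := hsol.elliptic _ (hmem 1 hn) v
      have h2 := hsch.u_one v
      simp only [Nat.cast_one, one_mul] at h1
      simp only [hw, hz1, hy, he, map_sub, sub_apply, zero_add, Nat.cast_one, one_mul]
      linarith
    · rw [hz]
      exact hsch.error_elliptic hsol hτ hN (fun _ => rfl) (fun _ => rfl) hn v
  have hβ : ∀ n, ‖y n‖ ^ 2 ≤ B * S.b (e n) (e n) := fun n =>
    calc ‖y n‖ ^ 2 ≤ (‖S.ι‖ * ‖e n‖) ^ 2 := by gcongr; exact S.ι.le_opNorm _
      _ ≤ (‖S.ι‖ ^ 2 + 1) * ‖e n‖ ^ 2 := by nlinarith [sq_nonneg ‖e n‖]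
      _ = B * (cb * ‖e n‖ ^ 2) := by rw [hB_def]; field_simp
      _ ≤ _ := by gcongr; exact hb _
  have hy0 : y 0 = 0 := by simp [hy, he, hsch.p_zero]
  have he1 : e 1 = p τ - p₁ := by simp [he, hsch.p_one]
  have hKR : K ≤ R := by
    have : 0 ≤ K * (59 + 36 * (‖S.d‖ + ‖S.c‖)) := by positivity
    rw [hR_def]; linarith
  have hKR' : 60 * K ≤ R := by
    have : 0 ≤ K * (36 * (‖S.d‖ + ‖S.c‖)) := by positivity
    rw [hR_def]; linarith
  have hy1 : ‖y 1‖ ^ 2 ≤ R * τ ^ 4 := by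
    have h1 : 0 ≤ τ * ‖p τ - p₁‖ ^ 2 := by positivity
    have h2 : K * τ ^ 4 ≤ R * τ ^ 4 := by gcongr
    simp only [hy, he1]
    linarith
  have hΔ1 : ∀ n, n + 2 ≤ N → ‖Δ n‖ ≤ R * τ ^ 2 := fun n hn => by
    have h := hp.norm_second_difference_le hT (x := n * τ) (by positivity) hτ.le
      (by rw [← ht2]; exact (hmem _ hn).2)
    refine h.trans ?_
    gcongr
    linarith
  have hΔ2 : ∀ n, n + 3 ≤ N → ‖Δ (n + 1) - Δ n‖ ≤ R * τ ^ 3 := fun n hn => by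
    have h := hp.norm_third_difference_le hT (x := n * τ) (by positivity) hτ.le
      (by rw [← ht3]; exact (hmem _ hn).2)
    have h2 : Δ (n + 1) - Δ n = S.ι (p (n * τ + 3 * τ)) - (3 : ℝ) • S.ι (p (n * τ + 2 * τ))
        + (3 : ℝ) • S.ι (p (n * τ + τ)) - S.ι (p (n * τ)) := by
      simp only [hΔ, ht1]
      rw [show (n : ℝ) * τ + τ + 2 * τ = n * τ + 3 * τ by ring,
        show (n : ℝ) * τ + τ + τ = n * τ + 2 * τ by ring]
      module
    rw [h2]
    refine h.trans ?_
    gcongr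
    linarith
  have heq : ∀ n, n + 2 ≤ N → S.c (bdf2 y n) (y (n + 2)) + s (bdf2 z n) (y (n + 2))
      + 2 * τ * S.b (e (n + 2)) (e (n + 2)) ≤ R * τ ^ 3 * ‖y (n + 2)‖ := by
    intro n hn
    have hLz : s (bdf2 z n) (y (n + 2)) = S.d (bdf2 w n) (y (n + 2)) := by
      rw [hs_apply]
      congr 2
      simp only [bdf2, map_add, map_sub, map_smul, hwz _ hn, hwz (n + 1) (by omega),
        hwz n (by omega)]
    have hιb : bdf2 y n = S.ι (bdf2 e n) := by simp only [bdf2, hy, map_add, map_sub, map_smul]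
    have h := hsch.error_parabolic hsol hT hu hp hτ hN (w := w) (e := e) (fun _ => rfl)
      (fun _ => rfl) hn
    have h' : 0 ≤ 60 * K * τ ^ 3 * ‖y (n + 2)‖ := by positivity
    rw [hLz, hιb, hR_def]
    linarith
  have hfin := hest τ hτ N y z Δ (fun n => S.b (e n) (e n)) hβ hy0 hy1 hz0 hz1 hz hΔ1 hΔ2 heq
  intro n hn
  have hb0 : ∀ q, 0 ≤ S.b q q := fun q => le_trans (by positivity) (hb q)
  have hsum0 : ∀ n, 0 ≤ τ * ∑ j ∈ Finset.Icc 2 n, S.b (e j) (e j) := fun n =>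
    mul_nonneg hτ.le (Finset.sum_nonneg fun j _ => hb0 _)
  set t := (1 + n * τ) * τ ^ 4 with ht
  have hτt : τ ^ 4 ≤ t := by
    have : 0 ≤ n * τ * τ ^ 4 := by positivity
    linarith
  have ht0 : 0 ≤ t := by positivity
  have hyt : ∀ k ≤ n, ‖y k‖ ^ 2 ≤ C * t := fun k hk => by
    have h1 : C * ((1 + k * τ) * τ ^ 4) ≤ C * t := by rw [ht]; gcongr
    linarith [hfin k (hk.trans hn), hsum0 k]
  have hzt : ‖z n‖ ^ 2
      ≤ (2 * (1 ^ 2 * (2 * (2 ^ 2 * C + (-1) ^ 2 * C)) + 1 ^ 2 * R ^ 2) + C) * t := by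
    have hCt : 0 ≤ C * t := by positivity
    have hRt : 0 ≤ R ^ 2 * t := by positivity
    rcases n with _ | _ | n
    · rw [hz0]; linarith [hyt 0 le_rfl]
    · rw [zero_add, hz1]; linarith [hyt 1 le_rfl]
    · have hΔt : ‖Δ n‖ ^ 2 ≤ R ^ 2 * t :=
        calc ‖Δ n‖ ^ 2 ≤ (R * τ ^ 2) ^ 2 := by gcongr; exact hΔ1 n hn
          _ = R ^ 2 * τ ^ 4 := by ring
          _ ≤ _ := by gcongr
      have h := norm_sq_smul_add_smul_le 1 1 (norm_sq_smul_add_smul_le 2 (-1)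
        (hyt (n + 1) (by omega)) (hyt n (by omega))) hΔt
      rw [one_smul, one_smul, neg_one_smul, ← sub_eq_add_neg, ← hz] at h
      linarith
  have hwt : ‖w n‖ ^ 2 ≤ ‖L‖ ^ 2
      * ((2 * (1 ^ 2 * (2 * (2 ^ 2 * C + (-1) ^ 2 * C)) + 1 ^ 2 * R ^ 2) + C) * t) :=
    calc ‖w n‖ ^ 2 ≤ (‖L‖ * ‖z n‖) ^ 2 := by
          gcongr; rw [hwz n hn]; exact L.le_opNorm _
      _ = ‖L‖ ^ 2 * ‖z n‖ ^ 2 := by ring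
      _ ≤ _ := by gcongr
  -- The energy sum starts at j = 2; the term j = 1 is controlled by the assumed accuracy of p¹ in
  -- `Q`.
  have hQ : τ * ∑ j ∈ Finset.Icc 1 n, ‖e j‖ ^ 2 ≤ K * t + 1 / cb * (C * t) := by
    have hcbt : 0 ≤ 1 / cb * (C * t) := by positivity
    have hKt : K * τ ^ 4 ≤ K * t := by gcongr
    rcases Nat.eq_zero_or_pos n with h0 | h0
    · rw [h0, Finset.Icc_eq_empty (by omega), Finset.sum_empty, mul_zero]
      positivity
    · have h1 : τ * ‖e 1‖ ^ 2 ≤ K * τ ^ 4 := by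
        rw [he1]; linarith [sq_nonneg ‖S.ι (p τ - p₁)‖]
      have h2 : ∑ j ∈ Finset.Icc 2 n, ‖e j‖ ^ 2
          ≤ 1 / cb * ∑ j ∈ Finset.Icc 2 n, S.b (e j) (e j) := by
        rw [Finset.mul_sum]
        refine Finset.sum_le_sum fun j _ => ?_
        rw [one_div, inv_mul_eq_div, le_div_iff₀ hcb]
        linarith [hb (e j)]
      have h3 : τ * ∑ j ∈ Finset.Icc 2 n, S.b (e j) (e j) ≤ C * t := by
        linarith [hfin n hn, sq_nonneg ‖y n‖]
      rw [← Finset.add_sum_Ioc_eq_sum_Icc h0, ← Finset.Icc_add_one_left_eq_Ioc, mul_add]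
      have h4 := mul_le_mul_of_nonneg_left h2 hτ.le
      have h5 := mul_le_mul_of_nonneg_left h3 (by positivity : 0 ≤ 1 / cb)
      norm_num only at h4 h5 ⊢
      linarith
  rw [mul_assoc _ (1 + (n : ℝ) * τ), ← ht]
  linarith [hyt n le_rfl]

end EllipticParabolicForms

/-! ### Poincaré's inequality and the forms of poroelasticity -/

namespace Poroelasticity

variable {m : ℕ}

/-- Poincaré's inequality for test functions, with a single partial derivative. -/
theorem integral_sq_le_of_hasCompactSupport {φ : EuclideanSpace ℝ (Fin m) → ℝ}
    (hφ : ContDiff ℝ 1 φ) (hc : HasCompactSupport φ) {R : ℝ}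
    (hR : ∀ x, φ x ≠ 0 → ‖x‖ ≤ R) (i : Fin m) :
    ∫ x, φ x ^ 2 ≤ 4 * R ^ 2 * ∫ x, fderiv ℝ φ x (EuclideanSpace.single i 1) ^ 2 := by
  set e : EuclideanSpace ℝ (Fin m) := EuclideanSpace.single i 1 with he
  have hφc : Continuous φ := hφ.continuous
  have hdc : Continuous fun x => fderiv ℝ φ x e :=
    (hφ.continuous_fderiv one_ne_zero).clm_apply continuous_const
  have hdcs : HasCompactSupport fun x => fderiv ℝ φ x e := hc.fderiv_apply ℝ e
  have hxc : Continuous fun x : EuclideanSpace ℝ (Fin m) => x i := by fun_prop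
  have hdiff : Differentiable ℝ φ := hφ.differentiable one_ne_zero
  have hder : ∀ x, fderiv ℝ (fun x : EuclideanSpace ℝ (Fin m) => x i * φ x) x e
      = φ x + x i * fderiv ℝ φ x e := by
    intro x
    have h1 : HasFDerivAt (fun x : EuclideanSpace ℝ (Fin m) => x i)
        (EuclideanSpace.proj i : EuclideanSpace ℝ (Fin m) →L[ℝ] ℝ) x :=
      (EuclideanSpace.proj i : EuclideanSpace ℝ (Fin m) →L[ℝ] ℝ).hasFDerivAt
    have h2 : HasFDerivAt (fun x : EuclideanSpace ℝ (Fin m) => x i * φ x) _ x :=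
      h1.mul (hdiff x).hasFDerivAt
    rw [h2.fderiv]
    simp [he]
    ring
  have hint : ∀ F : EuclideanSpace ℝ (Fin m) → ℝ, Continuous F → HasCompactSupport F →
      Integrable F := fun F h1 h2 => h1.integrable_of_hasCompactSupport h2
  have i1 : Integrable fun x => φ x ^ 2 :=
    hint _ (by fun_prop) (by simp only [sq]; exact hc.mul_left)
  have i2 : Integrable fun x => fderiv ℝ φ x e ^ 2 :=
    hint _ (by fun_prop) (by simp only [sq]; exact hdcs.mul_left)
  have i3 : Integrable fun x : EuclideanSpace ℝ (Fin m) => x i * φ x * fderiv ℝ φ x e :=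
    hint _ (by fun_prop) hdcs.mul_left
  have i4 : Integrable fun x : EuclideanSpace ℝ (Fin m) => (φ x + x i * fderiv ℝ φ x e) * φ x :=
    hint _ (by fun_prop) hc.mul_left
  -- Integrating xᵢφ against ∂ᵢφ by parts gives ∫φ² = -2∫ xᵢ φ ∂ᵢφ.
  have hparts := integral_mul_fderiv_eq_neg_fderiv_mul_of_integrable
    (μ := (volume : Measure (EuclideanSpace ℝ (Fin m))))
    (f := fun x : EuclideanSpace ℝ (Fin m) => x i * φ x) (g := φ) (v := e)
    (by simpa only [hder] using i4) i3 (hint _ (by fun_prop) hc.mul_left)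
    (fun x _ => by fun_prop) (fun x _ => hdiff x)
  simp only [hder] at hparts
  have hsplit : ∫ x, (φ x + x i * fderiv ℝ φ x e) * φ x
      = (∫ x, φ x ^ 2) + ∫ x : EuclideanSpace ℝ (Fin m), x i * φ x * fderiv ℝ φ x e := by
    rw [← integral_add i1 i3]
    exact integral_congr_ae (.of_forall fun x => by ring)
  -- Since |xᵢ| ≤ R wherever φ ≠ 0, Young's inequality leaves ½∫φ² to be absorbed; doubling 2R²
  -- gives 4R².
  have hle : ∫ x : EuclideanSpace ℝ (Fin m), -2 * (x i * φ x * fderiv ℝ φ x e)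
      ≤ ∫ x, (1 / 2 * φ x ^ 2 + 2 * R ^ 2 * fderiv ℝ φ x e ^ 2) := by
    refine integral_mono (i3.const_mul _) ((i1.const_mul _).add (i2.const_mul _)) fun x => ?_
    change -2 * (x i * φ x * fderiv ℝ φ x e) ≤ 1 / 2 * φ x ^ 2 + 2 * R ^ 2 * fderiv ℝ φ x e ^ 2
    by_cases h0 : φ x = 0
    · rw [h0]
      have : 0 ≤ R ^ 2 * fderiv ℝ φ x e ^ 2 := by positivity
      linarith
    · have h1 : x i ^ 2 ≤ R ^ 2 := by
        rw [← sq_abs]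
        have h2 : |x i| ≤ R := (PiLp.norm_apply_le x i).trans (hR x h0)
        gcongr
      have h3 := mul_le_mul_of_nonneg_right h1 (sq_nonneg (fderiv ℝ φ x e))
      linarith [sq_nonneg (φ x + 2 * (x i * fderiv ℝ φ x e))]
  rw [integral_const_mul, integral_add (i1.const_mul _) (i2.const_mul _), integral_const_mul,
    integral_const_mul] at hle
  linarith

variable (Ω : Set (EuclideanSpace ℝ (Fin m)))

/-- The test functions, paired with their gradients. -/
def testFunctions : Submodule ℝ (L2Graph Ω) where
  carrier := {w : L2Graph Ω | ∃ φ : EuclideanSpace ℝ (Fin m) → ℝ,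
      ContDiff ℝ ∞ φ ∧ HasCompactSupport φ ∧ tsupport φ ⊆ Ω ∧
      w.fst =ᵐ[volume.restrict Ω] φ ∧
      ∀ i : Fin m, w.snd i =ᵐ[volume.restrict Ω]
        fun x => fderiv ℝ φ x (EuclideanSpace.single i 1)}
  zero_mem' := by
    refine ⟨0, contDiff_zero_fun, HasCompactSupport.zero, by simp [tsupport],
      Lp.coeFn_zero _ _ _, fun i => ?_⟩
    filter_upwards [Lp.coeFn_zero ℝ 2 (volume.restrict Ω)] with x hx
    simpa using hx
  add_mem' := by
    rintro w w' ⟨φ, h1, h2, h3, h4, h5⟩ ⟨ψ, k1, k2, k3, k4, k5⟩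
    refine ⟨φ + ψ, h1.add k1, h2.add k2, (tsupport_add φ ψ).trans (union_subset h3 k3), ?_,
      fun i => ?_⟩
    · filter_upwards [Lp.coeFn_add w.fst w'.fst, h4, k4] with x hx a b
      simpa [a, b] using hx
    · filter_upwards [Lp.coeFn_add (w.snd i) (w'.snd i), h5 i, k5 i] with x hx a b
      rw [fderiv_add (h1.differentiable (by simp) x) (k1.differentiable (by simp) x)]
      simpa [a, b] using hx
  smul_mem' := by
    rintro c w ⟨φ, h1, h2, h3, h4, h5⟩
    refine ⟨c • φ, contDiff_const.smul h1, h2.smul_left (f := fun _ => c),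
      (tsupport_smul_subset_right (fun _ => c) φ).trans h3, ?_, fun i => ?_⟩
    · filter_upwards [Lp.coeFn_smul c w.fst, h4] with x hx a
      simpa [a] using hx
    · filter_upwards [Lp.coeFn_smul c (w.snd i), h5 i] with x hx a
      rw [fderiv_const_smul (h1.differentiable (by simp) x)]
      simpa [a] using hx

/-- The test pairs already form a subspace, so the span is superfluous and a closed condition on
`H10 Ω` need only be checked on test functions. -/
theorem H10_eq_closure_testFunctions : H10 Ω = (testFunctions Ω).topologicalClosure := by
  unfold H10
  congr 1
  exact Submodule.span_eq (testFunctions Ω)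

theorem norm_sq_eq_integral_of_ae_eq {Ω : Set (EuclideanSpace ℝ (Fin m))} {v : L2 Ω}
    {φ : EuclideanSpace ℝ (Fin m) → ℝ} (h : v =ᵐ[volume.restrict Ω] φ) (hs : tsupport φ ⊆ Ω) :
    ‖v‖ ^ 2 = ∫ x, φ x ^ 2 := by
  have h0 : ∫ x in Ω, φ x ^ 2 = ∫ x, φ x ^ 2 :=
    setIntegral_eq_integral_of_forall_compl_eq_zero
      (fun x hx => by rw [image_eq_zero_of_notMem_tsupport fun h => hx (hs h)]; simp)
  rw [← real_inner_self_eq_norm_sq, L2.inner_def, ← h0]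
  refine integral_congr_ae ?_
  filter_upwards [h] with x hx
  simp [hx, sq]

/-- Poincaré's inequality in `H¹₀(Ω)`, with a single partial derivative. -/
theorem norm_toL2_sq_le {Ω : Set (EuclideanSpace ℝ (Fin m))} {R : ℝ} (hR : ∀ x ∈ Ω, ‖x‖ ≤ R)
    (i : Fin m) (p : H10 Ω) : ‖toL2 Ω p‖ ^ 2 ≤ 4 * R ^ 2 * ‖partialDeriv Ω i p‖ ^ 2 := by
  set P := WithLp.fstL 2 ℝ (L2 Ω) (PiLp 2 (fun _ : Fin m => L2 Ω)) with hP
  set D := (PiLp.proj 2 (fun _ : Fin m => L2 Ω) i : _ →L[ℝ] L2 Ω).comp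
    (WithLp.sndL 2 ℝ (L2 Ω) (PiLp 2 (fun _ : Fin m => L2 Ω))) with hD
  have hclosed : IsClosed {w : L2Graph Ω | ‖P w‖ ^ 2 ≤ 4 * R ^ 2 * ‖D w‖ ^ 2} :=
    isClosed_le (by fun_prop) (by fun_prop)
  have hsub : (testFunctions Ω : Set (L2Graph Ω)) ⊆ {w | ‖P w‖ ^ 2 ≤ 4 * R ^ 2 * ‖D w‖ ^ 2} := by
    rintro w ⟨φ, h1, h2, h3, h4, h5⟩
    have hd : tsupport (fun x => fderiv ℝ φ x (EuclideanSpace.single i 1)) ⊆ Ω :=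
      (tsupport_fderiv_apply_subset ℝ _).trans h3
    change ‖w.fst‖ ^ 2 ≤ 4 * R ^ 2 * ‖w.snd i‖ ^ 2
    rw [norm_sq_eq_integral_of_ae_eq h4 h3, norm_sq_eq_integral_of_ae_eq (h5 i) hd]
    exact integral_sq_le_of_hasCompactSupport (h1.of_le (by simp)) h2
      (fun x hx => hR x (h3 (subset_tsupport φ hx))) i
  have hmem : (p : L2Graph Ω) ∈ closure (testFunctions Ω : Set (L2Graph Ω)) :=
    (H10_eq_closure_testFunctions Ω).le p.2
  exact closure_minimal hsub hclosed hmem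

theorem norm_H10_sq (p : H10 Ω) :
    ‖p‖ ^ 2 = ‖toL2 Ω p‖ ^ 2 + ∑ i, ‖partialDeriv Ω i p‖ ^ 2 := by
  have h1 : ‖p‖ ^ 2 = ‖(p : L2Graph Ω)‖ ^ 2 := rfl
  rw [h1, WithLp.prod_norm_sq_eq_of_L2, PiLp.norm_sq_eq_of_L2]
  rfl

theorem norm_H10_sq_le {Ω : Set (EuclideanSpace ℝ (Fin m))} {R : ℝ} (hR : ∀ x ∈ Ω, ‖x‖ ≤ R)
    (hm : 0 < m) (p : H10 Ω) :
    ‖p‖ ^ 2 ≤ (1 + 4 * R ^ 2) * ∑ i, ‖partialDeriv Ω i p‖ ^ 2 := by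
  have h1 := norm_toL2_sq_le hR ⟨0, hm⟩ p
  have h2 : ‖partialDeriv Ω ⟨0, hm⟩ p‖ ^ 2 ≤ ∑ i, ‖partialDeriv Ω i p‖ ^ 2 :=
    Finset.single_le_sum (f := fun i => ‖partialDeriv Ω i p‖ ^ 2) (fun i _ => sq_nonneg _)
      (Finset.mem_univ _)
  have h3 := mul_le_mul_of_nonneg_left h2 (by positivity : 0 ≤ 4 * R ^ 2)
  rw [norm_H10_sq]
  linarith

theorem norm_displacement_sq_le {Ω : Set (EuclideanSpace ℝ (Fin m))} {R : ℝ}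
    (hR : ∀ x ∈ Ω, ‖x‖ ≤ R) (hm : 0 < m) (u : Displacement Ω) :
    ‖u‖ ^ 2 ≤ (1 + 4 * R ^ 2) * gradNorm Ω u ^ 2 := by
  rw [gradNorm, Real.sq_sqrt (by positivity), PiLp.norm_sq_eq_of_L2, Finset.mul_sum]
  exact Finset.sum_le_sum fun i _ => norm_H10_sq_le hR hm (u i)

/-- The stress is 2μ ε(u) + λ (∇·u) id and the trace of ε(v) is ∇·v; in this form the symmetry of a
is visible. -/
theorem forms_a_apply (μ lam κ ν α M : ℝ) (u v : Displacement Ω) :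
    (forms Ω μ lam κ ν α M).a u v
      = ∑ i, ∑ j, 2 * μ * inner ℝ (strain Ω i j u) (strain Ω i j v)
        + lam * inner ℝ (divergence Ω u) (divergence Ω v) := by
  have hstrain : ∀ i j, strain Ω i j v = (1 / 2 : ℝ) • (grad Ω i j v + grad Ω j i v) :=
    fun i j => rfl
  have hstress : ∀ i j, stress Ω μ lam i j u
      = (2 * μ) • strain Ω i j u + if i = j then lam • divergence Ω u else 0 := by
    intro i j
    have h : strain Ω i j u = (1 / 2 : ℝ) • (grad Ω i j u + grad Ω j i u) := rfl
    rw [h, smul_smul, stress, add_apply]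
    split_ifs <;> simp only [smul_apply, add_apply, zero_apply] <;> module
  have hdiv : divergence Ω v = ∑ i, strain Ω i i v := by
    simp only [divergence, sum_apply, hstrain]
    exact Finset.sum_congr rfl fun i _ => by rw [← two_smul ℝ, smul_smul]; norm_num
  have ha : (forms Ω μ lam κ ν α M).a u v
      = ∑ i, ∑ j, inner ℝ (stress Ω μ lam i j u) (strain Ω i j v) := by
    simp [forms]
  rw [ha, hdiv, inner_sum, Finset.mul_sum, ← Finset.sum_add_distrib]
  refine Finset.sum_congr rfl fun i _ => ?_
  simp only [hstress, inner_add_left, Finset.sum_add_distrib, real_inner_smul_left]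
  congr 1
  rw [Finset.sum_eq_single i (fun j _ hj => by simp [hj.symm]) (by simp)]
  simp [real_inner_smul_left]

theorem forms_a_comm (μ lam κ ν α M : ℝ) (u v : Displacement Ω) :
    (forms Ω μ lam κ ν α M).a u v = (forms Ω μ lam κ ν α M).a v u := by
  rw [forms_a_apply, forms_a_apply, real_inner_comm]
  refine congrArg (· + _) (Finset.sum_congr rfl fun i _ => Finset.sum_congr rfl fun j _ => ?_)
  rw [real_inner_comm]

theorem forms_b_apply_self (μ lam κ ν α M : ℝ) (p : H10 Ω) :
    (forms Ω μ lam κ ν α M).b p p = κ / ν * ∑ i, ‖partialDeriv Ω i p‖ ^ 2 := by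
  simp [forms]

theorem isCompleteSpace_H10 : CompleteSpace (H10 Ω) := by
  unfold H10
  infer_instance

end Poroelasticity

/-- The weak coupling condition in terms of the norms induced by the elliptic forms. -/
theorem five_mul_sq_le_of_weak_coupling {ca cc Cd x r r' A C : ℝ} (hca : 0 < ca) (hcc : 0 < cc)
    (hω : Cd ^ 2 / (ca * cc) ≤ 1 / 5) (hx : |x| ≤ Cd * r * r') (hA : ca * r ^ 2 ≤ A)
    (hC : cc * r' ^ 2 ≤ C) : 5 * x ^ 2 ≤ A * C := by
  rw [div_le_iff₀ (by positivity)] at hω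
  calc 5 * x ^ 2 ≤ 5 * (Cd * r * r') ^ 2 := by rw [← sq_abs]; gcongr
    _ = 5 * Cd ^ 2 * (r ^ 2 * r' ^ 2) := by ring
    _ ≤ (ca * cc) * (r ^ 2 * r' ^ 2) :=
        mul_le_mul_of_nonneg_right (by linarith) (by positivity)
    _ = (ca * r ^ 2) * (cc * r' ^ 2) := by ring
    _ ≤ A * C := by gcongr; exact le_trans (by positivity) hA

/-- A one-sided bound is two-sided, because q may be replaced by -q. -/
theorem EllipticParabolicForms.abs_d_le {V H Q : Type*}
    [NormedAddCommGroup V] [InnerProductSpace ℝ V]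
    [NormedAddCommGroup H] [InnerProductSpace ℝ H]
    [NormedAddCommGroup Q] [InnerProductSpace ℝ Q]
    (S : EllipticParabolicForms V H Q) {C : V → ℝ}
    (h : ∀ u q, S.d u q ≤ C u * ‖q‖) (u : V) (q : H) : |S.d u q| ≤ C u * ‖q‖ := by
  have h' := h u (-q)
  rw [map_neg, norm_neg] at h'
  exact abs_le.2 ⟨by linarith, h u q⟩

/-! ### The abstract theorem and its poroelastic case -/

theorem mainTheorem1 :
    -- the abstract elliptic-parabolic system
    (∀ (V H Q : Type*)
        [NormedAddCommGroup V] [InnerProductSpace ℝ V] [CompleteSpace V]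
        [NormedAddCommGroup H] [InnerProductSpace ℝ H] [CompleteSpace H]
        [NormedAddCommGroup Q] [InnerProductSpace ℝ Q] [CompleteSpace Q]
        (S : EllipticParabolicForms V H Q) (ca cb cc Cd : ℝ),
        0 < ca → 0 < cb → 0 < cc → 0 < Cd →
        (∀ u v, S.a u v = S.a v u) → (∀ u, ca * ‖u‖ ^ 2 ≤ S.a u u) →
        (∀ p q, S.b p q = S.b q p) → (∀ p, cb * ‖p‖ ^ 2 ≤ S.b p p) →
        (∀ p q, S.c p q = S.c q p) → (∀ p, cc * ‖p‖ ^ 2 ≤ S.c p p) →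
        (∀ u q, S.d u q ≤ Cd * ‖u‖ * ‖q‖) →
        Cd ^ 2 / (ca * cc) ≤ 1 / 5 →
        S.SecondOrderConvergence) ∧
    -- linear poroelasticity on a bounded domain in two or three dimensions
    (∀ (m : ℕ) (Ω : Set (EuclideanSpace ℝ (Fin m))) (μ lam κ ν α M ca cc Cd : ℝ),
        m = 2 ∨ m = 3 → IsOpen Ω → Bornology.IsBounded Ω →
        0 < κ → 0 < ν → 0 < M → 0 < ca → 0 < cc → 0 < Cd →
        (∀ u, ca * Poroelasticity.gradNorm Ω u ^ 2
          ≤ (Poroelasticity.forms Ω μ lam κ ν α M).a u u) →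
        (∀ p, cc * ‖p‖ ^ 2 ≤ (Poroelasticity.forms Ω μ lam κ ν α M).c p p) →
        (∀ u q, (Poroelasticity.forms Ω μ lam κ ν α M).d u q
          ≤ Cd * Poroelasticity.gradNorm Ω u * ‖q‖) →
        Cd ^ 2 / (ca * cc) ≤ 1 / 5 →
        (Poroelasticity.forms Ω μ lam κ ν α M).SecondOrderConvergence) := by
  refine ⟨?_, ?_⟩
  · intro V H Q _ _ _ _ _ _ _ _ _ S ca cb cc Cd hca hcb hcc _ hasymm ha _ hb hcsymm hc hd hω
    exact S.secondOrderConvergence hca hcb hcc hasymm ha hb hcsymm hc fun u q =>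
      five_mul_sq_le_of_weak_coupling hca hcc hω (S.abs_d_le hd u q) (ha u) (hc q)
  · intro m Ω μ lam κ ν α M ca cc Cd hm _ hbdd hκ hν _ hca hcc _ ha hc hd hω
    have hm0 : 0 < m := by omega
    obtain ⟨R, hR⟩ := hbdd.exists_norm_le
    have := Poroelasticity.isCompleteSpace_H10 Ω
    have hP : 0 < 1 + 4 * R ^ 2 := by positivity
    -- Only the coercivity constants of a and b in the full norms carry the Poincaré factor; the
    -- coupling is verified below with the gradient norm and the original ca.
    refine (Poroelasticity.forms Ω μ lam κ ν α M).secondOrderConvergence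
      (ca := ca / (1 + 4 * R ^ 2)) (cb := κ / ν / (1 + 4 * R ^ 2)) (by positivity)
      (by positivity) hcc (fun u v => ?_) (fun u => ?_) (fun p => ?_) (fun p q => ?_) hc
      (fun u q => ?_)
    · exact Poroelasticity.forms_a_comm Ω μ lam κ ν α M u v
    · refine le_trans ?_ (ha u)
      rw [div_mul_eq_mul_div, div_le_iff₀ hP, mul_assoc]
      gcongr
      linarith [Poroelasticity.norm_displacement_sq_le hR hm0 u]
    · rw [Poroelasticity.forms_b_apply_self, div_mul_eq_mul_div, div_le_iff₀ hP, mul_assoc]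
      gcongr
      linarith [Poroelasticity.norm_H10_sq_le hR hm0 p]
    · exact congrArg (1 / M * ·) (real_inner_comm q p)
    · exact five_mul_sq_le_of_weak_coupling hca hcc hω
        ((Poroelasticity.forms Ω μ lam κ ν α M).abs_d_le hd u q) (ha u) (hc q)
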